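/- Let $F(X,Y)\in\mathbb{Z}[X,Y]$ be a binary form (homogeneous polynomial) of degree $n\geq 3$ with non-zero discriminant $D(F)$, where $D(F)=\prod_{1\le i<j\le n}(\alpha_i\beta_j-\alpha_j\beta_i)^2$ if $F=\prod_{i=1}^n(\alpha_iX+\beta_iY)$ over $\mathbb{C}$. Let $0<\epsilon<\frac1n$ be a real number and let $S$ be a finite set of primes. For a non-zero integer $m$ let $[m]_S:=\prod_{p\in S}p^{v_p(m)}$ denote its $S$-part, where $v_p(m)$ is the exponent of $p$ in $m$. For real $B>0$ let $N(F,S,\epsilon,B)$ be the number of pairs $(x,y)\in\mathbb{Z}^2$ with $$\gcd(x,y)=1,\quad \max(|x|,|y|)\leq B,\quad F(x,y)\neq 0,\quad [F(x,y)]_S\geq |F(x,y)|^{\epsilon}.$$ For a prime $p$ let $g_p$ be the exponent of $p$ in $D(F)$, and let $s'$ be the number of primes $p\in S$ such that the congruence $F(x,y)\equiv 0\pmod{p^{g_p+1}}$ has a solution $(x,y)\in\mathbb{Z}^2$ with $\gcd(x,y)=1$. Assume that $s'>0$. Then $$N(F,S,\epsilon,B)\asymp_{F,S,\epsilon} B^{2-n\epsilon}(\log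 B)^{s'-1}\quad\text{as } B\to\infty,$$ that is, there are positive constants $c_1,c_2,B_0$, depending only on $F,S,\epsilon$, such that $c_1B^{2-n\epsilon}(\log B)^{s'-1}\leq N(F,S,\epsilon,B)\leq c_2B^{2-n\epsilon}(\log B)^{s'-1}$ for all $B\geq B_0$. -/

import Mathlib

open Filter Asymptotics

noncomputable section

/-- The `S`-part `[m]_S = ∏_{p ∈ S} p ^ v_p(m)` of a non-zero integer `m`. -/
def sPart (S : Finset ℕ) (m : ℤ) : ℕ :=
  ∏ p ∈ S, p ^ padicValInt p m

/-- The value `F(x, y)` of a polynomial in two variables at an integer point. -/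
def formVal (F : MvPolynomial (Fin 2) ℤ) (x y : ℤ) : ℤ :=
  MvPolynomial.eval ![x, y] F

/-- The dehomogenization `f(X) = F(X, 1)`. -/
def dehomog (F : MvPolynomial (Fin 2) ℤ) : Polynomial ℤ :=
  MvPolynomial.aeval ![(Polynomial.X : Polynomial ℤ), 1] F

/-- The discriminant `D(F)` of a binary form `F` of degree `n ≥ 2`, that is,
`∏_{i < j} (αᵢ βⱼ - αⱼ βᵢ) ^ 2` where `F = ∏ᵢ (αᵢ X + βᵢ Y)` over `ℂ`.
Write `F = a₀ X ^ n + a₁ X ^ (n - 1) Y + ⋯ + aₙ Y ^ n` and `f(X) = F(X, 1)`.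
If `a₀ ≠ 0`, then `D(F)` is the discriminant of `f`, a polynomial of degree `n`.
If `a₀ = 0`, then `F = Y G` with `G(1, 0) = a₁`, and `D(F) = G(1, 0) ^ 2 * D(G)`: this is `0` if
`a₁ = 0`, and `a₁ ^ 2` times the discriminant of `f = G(X, 1)`, a polynomial of degree `n - 1`,
if `a₁ ≠ 0`. -/
def formDiscr (n : ℕ) (F : MvPolynomial (Fin 2) ℤ) : ℤ :=
  if (dehomog F).coeff n ≠ 0 then (dehomog F).discr
  else (dehomog F).coeff (n - 1) ^ 2 * (dehomog F).discr

/-- The congruence `F(x, y) ≡ 0 (mod m)` has a solution in coprime integers `x, y`. -/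
def HasPrimitiveSolMod (F : MvPolynomial (Fin 2) ℤ) (m : ℤ) : Prop :=
  ∃ x y : ℤ, IsCoprime x y ∧ formVal F x y ≡ 0 [ZMOD m]

open Classical in
/-- The number `s'` of primes `p ∈ S` such that `F(x, y) ≡ 0 (mod p ^ (g_p + 1))` has a primitive
solution, where `g_p` is the exponent of `p` in the discriminant of `F`. -/
def numSolvablePrimes (n : ℕ) (F : MvPolynomial (Fin 2) ℤ) (S : Finset ℕ) : ℕ :=
  (S.filter fun p : ℕ => HasPrimitiveSolMod F ((p : ℤ) ^ (padicValInt p (formDiscr n F) + 1))).card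

/-- The number `N(F, S, ε, B)` of pairs of coprime integers `(x, y)` with `max(|x|, |y|) ≤ B`,
`F(x, y) ≠ 0` and `[F(x, y)]_S ≥ |F(x, y)| ^ ε` (a bounded, hence finite, set of pairs). -/
def countLargeSPart (F : MvPolynomial (Fin 2) ℤ) (S : Finset ℕ) (ε B : ℝ) : ℕ :=
  Set.ncard {z : ℤ × ℤ | IsCoprime z.1 z.2 ∧ max |(z.1 : ℝ)| |(z.2 : ℝ)| ≤ B ∧
    formVal F z.1 z.2 ≠ 0 ∧
    |(formVal F z.1 z.2 : ℝ)| ^ ε ≤ (sPart S (formVal F z.1 z.2) : ℝ)}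

end

/-! At a primitive point a prime `p ∈ S` without a primitive zero modulo `p ^ (g_p + 1)` contributes
at most `p ^ g_p` to the `S`-part (`sPart_le_mul_prod`), so only the set `T` of the `s'` solvable
primes matters. The condition says, up to constants, that `F(x, y)` is divisible by an integer `M`
composed of primes of `T`, of size about `|F(x, y)| ^ ε`, typically `B ^ (n ε)`. For given `M` this
should leave about `B² / M` points, that is `B ^ (2 - n ε)`, and there are about `(log B) ^ (s' -
1)` such `M` in an interval `[Y, P Y]` with `Y` a power of `B` (`card_smoothBetween_le`,
`le_card_smoothBetween`).

Both bounds rest on the discriminant lying in the ideal `(a, b²)`, where `a`, `b` are the two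
leading coefficients of the form (`discr_mem_span_coeff`). After a unimodular substitution any
primitive point becomes `(1, 0)`, so a zero modulo `p ^ (g_p + 1)` is simple enough to be rigid
(`pow_dvd_pow_mul_det`) and to lift to the `p`-adic integers (`exists_padic_zero`).

Upper bound: points are sorted dyadically by height `2 ^ i` and by value `2 ^ j` of the form. Points
of one class modulo a fixed integer and near one root line have determinants that are almost
divisible by `M` (`pow_dvd_pow_mul_det`) and small (`exists_coloring`), which limits their number
(`card_primitive_le`, `exists_card_shell_le`). The double sum over `i`, `j` is geometric and
dominated by the largest height and value; here `n ε < 1` makes the constant terms negligible.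

Lower bound: for each `M` in a range where the `S`-part condition is automatic, the primitive points
on a line modulo a multiple of `M` close to the `p`-adic zeros are counted by `le_card_coprime`. The
lines are shifted so that a point determines `M`; hence the counts add up. -/

/-! ### The discriminant of a polynomial -/

/-- Multilinearity in row `j`: the `τ` term carries the factor `a² = 0`, and the other two terms
have a repeated row once `a` is pulled out of row `i`. -/
theorem det_eq_zero_of_sq_zero_rows {R m : Type*} [CommRing R] [Fintype m] [DecidableEq m]
    (M : Matrix m m R) {i j l : m} (hij : i ≠ j) (hjl : j ≠ l) (hil : i ≠ l) {a x y : R}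
    (ha : a * a = 0) (ρ τ : m → R) (hi : M i = a • ρ) (hj : M j = a • τ + x • ρ + y • M l) :
    M.det = 0 := by
  have h1 : M = (M.updateRow i (a • ρ)).updateRow j (a • τ + x • ρ + y • M l) := by
    rw [← hi, ← hj]; simp
  rw [h1, Matrix.det_updateRow_add, Matrix.det_updateRow_add, Matrix.det_updateRow_smul,
    Matrix.det_updateRow_smul, Matrix.det_updateRow_smul]
  have h2 : ((M.updateRow i (a • ρ)).updateRow j (M l)).det = 0 := by
    apply Matrix.det_zero_of_row_eq hjl
    rw [Matrix.updateRow_self, Matrix.updateRow_ne hjl.symm, Matrix.updateRow_ne hil.symm]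
  have h3 (v : m → R) : ((M.updateRow i (a • ρ)).updateRow j v).det =
      a * ((M.updateRow i ρ).updateRow j v).det := by
    rw [Matrix.updateRow_comm _ hij, Matrix.det_updateRow_smul, Matrix.updateRow_comm _ hij]
  have h4 : ((M.updateRow i ρ).updateRow j ρ).det = 0 := by
    apply Matrix.det_zero_of_row_eq hij
    rw [Matrix.updateRow_self, Matrix.updateRow_ne hij, Matrix.updateRow_self]
  rw [h2, h3, h3, h4, ← mul_assoc, ha]
  ring

-- Modulo the two generators, three of the last rows of the Sylvester-type matrix have the shape
-- required by `det_eq_zero_of_sq_zero_rows`. The consequence used later: if `p ^ (g + 1)` divides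
-- the leading coefficient but not the discriminant, then it does not divide the square of the next
-- coefficient.
open Polynomial in
theorem discr_mem_span_coeff {R : Type*} [CommRing R] (f : R[X]) {n : ℕ} (hf : f.natDegree = n)
    (hn : 3 ≤ n) : f.discr ∈ Ideal.span {f.coeff n, f.coeff (n - 1) ^ 2} := by
  subst hf
  set n := f.natDegree with hn'
  set I := Ideal.span {f.coeff n, f.coeff (n - 1) ^ 2} with hI
  rw [discr]
  apply Ideal.mul_mem_right
  rw [← Ideal.Quotient.eq_zero_iff_mem, RingHom.map_det]
  have h0 : Ideal.Quotient.mk I (f.coeff n) = 0 :=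
    Ideal.Quotient.eq_zero_iff_mem.2 (Ideal.subset_span (by simp))
  have h1 : Ideal.Quotient.mk I (f.coeff (n - 1)) * Ideal.Quotient.mk I (f.coeff (n - 1)) = 0 := by
    rw [← map_mul, ← sq]
    exact Ideal.Quotient.eq_zero_iff_mem.2 (Ideal.subset_span (by simp))
  have hn0 : n ≠ 0 := by omega
  have e1 : n - 1 + 1 = n := by omega
  have e2 : n - 2 + 1 = n - 1 := by omega
  have e3 : n - 3 + 1 = n - 2 := by omega
  have c1 : ((n - 1 : ℕ) : R ⧸ I) = n - 1 := by rw [Nat.cast_sub (by omega)]; simp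
  have c2 : ((n - 2 : ℕ) : R ⧸ I) = n - 2 := by rw [Nat.cast_sub (by omega)]; simp
  refine det_eq_zero_of_sq_zero_rows _ (i := ⟨2 * n - 3, by omega⟩) (j := ⟨2 * n - 4, by omega⟩)
    (l := ⟨2 * n - 2, by omega⟩) (by simp; omega) (by simp; omega) (by simp; omega)
    (a := Ideal.Quotient.mk I (f.coeff (n - 1))) (x := 2 * Ideal.Quotient.mk I (f.coeff (n - 2)))
    (y := - Ideal.Quotient.mk I (f.coeff (n - 2))) h1
    (fun k ↦ if (k : ℕ) = n - 2 then 1 else if (k : ℕ) = 2 * n - 2 then ((n - 1 : ℕ) : R ⧸ I)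
      else 0)
    (fun k ↦ if (k : ℕ) = n - 3 then 1 else if (k : ℕ) = 2 * n - 3 then ((n - 1 : ℕ) : R ⧸ I)
      else 0) ?_ ?_
  · ext ⟨k, hk⟩
    simp only [sylvesterDeriv, ← hn', hn0, dite_false, RingHom.mapMatrix_apply, Matrix.map_apply]
    rw [Matrix.updateRow_ne (by simp; omega)]
    simp only [sylvester, Matrix.of_apply, Fin.addCases, Set.mem_Icc, coeff_derivative,
      eq_rec_constant, Pi.smul_apply, smul_eq_mul, Fin.val_castLT, Fin.val_subNat, Fin.val_cast,
      dite_eq_ite]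
    rcases lt_or_ge k (n - 1) with hk1 | hk1
    · rw [if_pos hk1]
      rcases (by omega : k = n - 2 ∨ k = n - 3 ∨ k < n - 3) with h | h | h
      · rw [if_pos (by omega), if_pos h, show 2 * n - 3 - k = n - 1 by omega, mul_one]
      · rw [if_pos (by omega), if_neg (by omega), if_neg (by omega),
          show 2 * n - 3 - k = n by omega, mul_zero, h0]
      · rw [if_neg (by omega), if_neg (by omega), if_neg (by omega), mul_zero, map_zero]
    · rw [if_neg (by omega), if_neg (show ¬ k = n - 2 by omega)]
      rcases (by omega : k = 2 * n - 2 ∨ k = 2 * n - 3 ∨ k < 2 * n - 3) with h | h | h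
      · rw [if_pos (by omega), if_pos h, show 2 * n - 3 - (k - (n - 1)) = n - 2 by omega, e2]
        rw [map_mul, ← Nat.cast_one (R := R), ← Nat.cast_add, e2, map_natCast]
      · rw [if_pos (by omega), if_neg (by omega),
          show 2 * n - 3 - (k - (n - 1)) = n - 1 by omega, e1, map_mul, h0]
        simp
      · rw [if_neg (by omega), if_neg (by omega), mul_zero, map_zero]
  · ext ⟨k, hk⟩
    simp only [sylvesterDeriv, ← hn', hn0, dite_false, RingHom.mapMatrix_apply, Matrix.map_apply,
      Pi.add_apply, Pi.smul_apply]
    rw [Matrix.updateRow_ne (by simp; omega), Matrix.updateRow_self]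
    simp only [sylvester, Matrix.of_apply, Fin.addCases, Set.mem_Icc, coeff_derivative,
      eq_rec_constant, smul_eq_mul, Fin.val_castLT, Fin.val_subNat, Fin.val_cast,
      dite_eq_ite]
    rcases lt_or_ge k (n - 1) with hk1 | hk1
    · rw [if_pos hk1]
      rcases (by omega : k = n - 2 ∨ k = n - 3 ∨ k + 4 = n ∨ k + 4 < n) with h | h | h | h
      · rw [if_pos (by omega), if_neg (by omega), if_neg (by omega), if_pos h, if_pos h,
          show 2 * n - 4 - k = n - 2 by omega, map_one]
        ring
      · rw [if_pos (by omega), if_pos (by omega), if_neg (by omega), if_neg (by omega),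
          if_neg (by omega), if_neg (by omega), show 2 * n - 4 - k = n - 1 by omega, map_zero]
        ring
      · rw [if_pos (by omega), if_neg (by omega), if_neg (by omega), if_neg (by omega),
          if_neg (by omega), if_neg (by omega), if_neg (by omega),
          show 2 * n - 4 - k = n by omega, map_zero, h0]
        ring
      · rw [if_neg (by omega), if_neg (by omega), if_neg (by omega), if_neg (by omega),
          if_neg (by omega), if_neg (by omega), if_neg (by omega), map_zero]
        ring
    · rw [if_neg (by omega), if_neg (show ¬ k = n - 2 by omega), if_neg (show ¬ k = n - 3 by omega),
        if_neg (show ¬ k = n - 2 by omega)]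
      rcases (by omega : k = 2 * n - 2 ∨ k = 2 * n - 3 ∨ k = 2 * n - 4 ∨ k < 2 * n - 4) with
        h | h | h | h
      · rw [if_pos (by omega), if_neg (by omega), if_pos h, if_pos h,
          show 2 * n - 4 - (k - (n - 1)) = n - 3 by omega, e3,
          map_mul, ← Nat.cast_one (R := R), ← Nat.cast_add, e3, map_natCast, map_natCast, c1, c2]
        ring
      · rw [if_pos (by omega), if_pos h, if_neg (by omega), if_neg (by omega),
          show 2 * n - 4 - (k - (n - 1)) = n - 2 by omega, e2,
          map_mul, ← Nat.cast_one (R := R), ← Nat.cast_add, e2, map_natCast, map_zero]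
        ring
      · rw [if_pos (by omega), if_neg (by omega), if_neg (by omega), if_neg (by omega),
          show 2 * n - 4 - (k - (n - 1)) = n - 1 by omega, e1, map_mul, h0, map_zero]
        ring
      · rw [if_neg (by omega), if_neg (by omega), if_neg (by omega), if_neg (by omega),
          map_zero]
        ring

open Polynomial in
theorem discr_map_of_injective {R S : Type*} [CommRing R] [CommRing S] [IsDomain S] (φ : R →+* S)
    (hφ : Function.Injective φ) {f : R[X]} (hf : 0 < f.natDegree) :
    (f.map φ).discr = φ f.discr := by
  have h1 := resultant_deriv (natDegree_pos_iff_degree_pos.1 hf)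
  have h2 := resultant_deriv (f := f.map φ)
    (natDegree_pos_iff_degree_pos.1 (by rwa [natDegree_map_eq_of_injective hφ]))
  rw [natDegree_map_eq_of_injective hφ, derivative_map, resultant_map_map, h1,
    leadingCoeff_map_of_injective hφ] at h2
  simp only [map_mul, map_pow, map_neg, map_one] at h2
  have h3 : φ f.leadingCoeff ≠ 0 := by
    rw [map_ne_zero_iff φ hφ, leadingCoeff_ne_zero]
    rintro rfl
    simp at hf
  have h4 : ((-1 : S) ^ (f.natDegree * (f.natDegree - 1) / 2) * φ f.leadingCoeff) ≠ 0 :=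
    mul_ne_zero (pow_ne_zero _ (neg_ne_zero.2 one_ne_zero)) h3
  exact (mul_left_cancel₀ h4 h2).symm

-- The resultant with the derivative is a product of values of the derivative at the roots `-β i / α
-- i`. Squaring discards the sign, both in the definition of the discriminant and in the passage
-- from pairs `i < j` to ordered pairs.
open Polynomial in
theorem discr_sq_of_eq_prod_linear {K ι : Type*} [Field K] [DecidableEq ι] {c : K} (hc : c ≠ 0)
    {s : Finset ι} (hs : s.Nonempty) (α β : ι → K) (hα : ∀ i ∈ s, α i ≠ 0) :
    (C c * ∏ i ∈ s, (C (α i) * X + C (β i))).discr ^ 2 =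
      (c ^ (2 * (s.card - 1)) * ∏ i ∈ s, ∏ j ∈ s.erase i, (α i * β j - α j * β i)) ^ 2 := by
  set Q := C c * ∏ i ∈ s, (C (α i) * X + C (β i)) with hQ
  have hd : ∀ i ∈ s, (C (α i) * X + C (β i)).natDegree = 1 := fun i hi ↦
    natDegree_linear (hα i hi)
  have hl : ∀ i ∈ s, (C (α i) * X + C (β i)).leadingCoeff = α i := fun i hi ↦
    leadingCoeff_linear (hα i hi)
  have h0 : ∀ i ∈ s, (C (α i) * X + C (β i)) ≠ 0 := fun i hi ↦
    ne_zero_of_natDegree_gt (n := 0) (by rw [hd i hi]; exact one_pos)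
  have hdeg : Q.natDegree = s.card := by
    rw [hQ, natDegree_C_mul hc, natDegree_prod _ _ h0, Finset.sum_congr rfl hd]
    simp
  have hlc : Q.leadingCoeff = c * ∏ i ∈ s, α i := by
    rw [hQ, leadingCoeff_mul, leadingCoeff_C, leadingCoeff_prod, Finset.prod_congr rfl hl]
  have hP : ∏ i ∈ s, α i ≠ 0 := Finset.prod_ne_zero_iff.2 hα
  have hroots : Q.roots = s.val.map fun i ↦ -(β i) / α i := by
    rw [hQ, roots_C_mul _ hc, roots_prod _ _ (Finset.prod_ne_zero_iff.2 h0)]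
    rw [← Multiset.bind_singleton]
    refine Multiset.bind_congr fun i hi ↦ ?_
    rw [roots_C_mul_X_add_C _ (hα i hi)]
    congr 1
    simp [div_eq_mul_inv, mul_comm]
  have hsplit : Q.Splits := by
    rw [splits_iff_card_roots, hroots, hdeg, Multiset.card_map, Finset.card_val]
  have hcard : 1 ≤ s.card := hs.card_pos
  have hres := resultant_deriv (f := Q) (natDegree_pos_iff_degree_pos.1 (by omega))
  rw [resultant_eq_prod_eval Q _ _ (natDegree_derivative_le _) hsplit, hroots, hdeg,
    Multiset.map_map, hlc] at hres
  change _ * ∏ i ∈ s, (eval (-β i / α i) Q.derivative) = _ at hres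
  have hder : ∀ i ∈ s, α i ^ (s.card - 1) * eval (-β i / α i) Q.derivative =
      c * α i * ∏ j ∈ s.erase i, (α i * β j - α j * β i) := by
    intro i hi
    have : eval (-β i / α i) Q.derivative =
        c * α i * ∏ j ∈ s.erase i, (α j * (-β i / α i) + β j) := by
      rw [hQ, derivative_C_mul, derivative_prod_finset, eval_C_mul, eval_finsetSum,
        Finset.sum_eq_single_of_mem i hi]
      · simp [eval_prod]; ring
      · intro j hj hji
        rw [eval_mul, eval_prod, Finset.prod_eq_zero (Finset.mem_erase.2 ⟨hji.symm, hi⟩), zero_mul]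
        have := hα i hi
        simp; field_simp; ring
    rw [this, ← Finset.card_erase_of_mem hi, mul_left_comm, ← Finset.prod_const,
      ← Finset.prod_mul_distrib]
    congr 1
    refine Finset.prod_congr rfl fun j _ ↦ ?_
    have := hα i hi
    field_simp; ring
  have hprod := Finset.prod_congr (rfl : s = s) hder
  rw [Finset.prod_mul_distrib, Finset.prod_pow, Finset.prod_mul_distrib, Finset.prod_mul_distrib,
    Finset.prod_const] at hprod
  rw [mul_pow, mul_assoc, hprod] at hres
  have hc1 : c ^ s.card = c ^ (s.card - 1) * c := by rw [← pow_succ]; congr 1; omega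
  have hc2 : c ^ (2 * (s.card - 1)) = c ^ (s.card - 1) * c ^ (s.card - 1) := by
    rw [two_mul, pow_add]
  have hσ : ((-1 : K) ^ (s.card * (s.card - 1) / 2)) ^ 2 = 1 := by
    rw [← pow_mul, mul_comm, pow_mul]; simp
  rw [hc1] at hres
  rw [hc2]
  generalize (-1 : K) ^ (s.card * (s.card - 1) / 2) = σ at hres hσ
  generalize c ^ (s.card - 1) = u at hres
  generalize ∏ i ∈ s, ∏ j ∈ s.erase i, (α i * β j - α j * β i) = Δ at hres
  generalize ∏ i ∈ s, α i = P at hres hP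
  have hne : c ^ 2 * P ^ 2 ≠ 0 := mul_ne_zero (pow_ne_zero _ hc) (pow_ne_zero _ hP)
  apply mul_left_cancel₀ hne
  linear_combination (-(c ^ 2 * P ^ 2 * Q.discr ^ 2)) * hσ -
    (u * (u * c * P * Δ) + σ * (c * P) * Q.discr) * hres

/-! ### Binary forms: linear factors, discriminant, unimodular substitution -/

/-- The form `F(x X + u Y, y X + v Y)`. -/
noncomputable def linSubst (F : MvPolynomial (Fin 2) ℤ) (x u y v : ℤ) : MvPolynomial (Fin 2) ℤ :=
  MvPolynomial.aeval ![MvPolynomial.C x * MvPolynomial.X 0 + MvPolynomial.C u * MvPolynomial.X 1,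
    MvPolynomial.C y * MvPolynomial.X 0 + MvPolynomial.C v * MvPolynomial.X 1] F

/-- `F` is the product over `ℂ` of the linear forms `α i X + β i Y`. -/
def IsLinearFactorization {n : ℕ} (F : MvPolynomial (Fin 2) ℤ) (α β : Fin n → ℂ) : Prop :=
  MvPolynomial.map (Int.castRingHom ℂ) F =
    ∏ i, (MvPolynomial.C (α i) * MvPolynomial.X 0 + MvPolynomial.C (β i) * MvPolynomial.X 1)

theorem IsLinearFactorization.formVal_eq {n : ℕ} {F : MvPolynomial (Fin 2) ℤ} {α β : Fin n → ℂ}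
    (h : IsLinearFactorization F α β) (x y : ℤ) :
    (formVal F x y : ℂ) = ∏ i, (α i * x + β i * y) := by
  have h1 := congrArg (MvPolynomial.eval ![(x : ℂ), (y : ℂ)]) h
  rw [MvPolynomial.eval_map, MvPolynomial.eval_prod] at h1
  simp only [map_add, map_mul, MvPolynomial.eval_C, MvPolynomial.eval_X, Matrix.cons_val_zero,
    Matrix.cons_val_one] at h1
  rw [← h1, formVal, ← eq_intCast (Int.castRingHom ℂ), MvPolynomial.eval, MvPolynomial.coe_eval₂Hom,
    MvPolynomial.eval₂_comp_left (Int.castRingHom ℂ)]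
  congr 1
  ext i; fin_cases i <;> simp

theorem IsLinearFactorization.linSubst {n : ℕ} {F : MvPolynomial (Fin 2) ℤ} {α β : Fin n → ℂ}
    (h : IsLinearFactorization F α β) (x u y v : ℤ) :
    IsLinearFactorization (linSubst F x u y v) (fun i ↦ α i * x + β i * y)
      (fun i ↦ α i * u + β i * v) := by
  unfold IsLinearFactorization at h ⊢
  have h1 := congrArg (MvPolynomial.aeval
    ![MvPolynomial.C (x : ℂ) * MvPolynomial.X 0 + MvPolynomial.C (u : ℂ) * MvPolynomial.X 1,
    MvPolynomial.C (y : ℂ) * MvPolynomial.X 0 + MvPolynomial.C (v : ℂ) * MvPolynomial.X (1 : Fin 2)]) h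
  rw [map_prod] at h1
  convert h1 using 1
  · rw [_root_.linSubst, MvPolynomial.aeval_def, MvPolynomial.aeval_def, MvPolynomial.eval₂_map,
      MvPolynomial.eval₂_comp_left (MvPolynomial.map (Int.castRingHom ℂ))]
    congr 1
    · exact RingHom.ext_int _ _
    · ext i; fin_cases i <;> simp
  · refine Finset.prod_congr rfl fun i _ ↦ ?_
    simp only [map_add, map_mul, MvPolynomial.aeval_X, MvPolynomial.algHom_C, MvPolynomial.algebraMap_eq, Matrix.cons_val_zero, Matrix.cons_val_one]
    ring

open Polynomial in
theorem IsLinearFactorization.dehomog_map {n : ℕ} {F : MvPolynomial (Fin 2) ℤ} {α β : Fin n → ℂ}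
    (h : IsLinearFactorization F α β) :
    (dehomog F).map (Int.castRingHom ℂ) = ∏ i, (C (α i) * X + C (β i)) := by
  have h1 := congrArg (MvPolynomial.aeval ![(X : ℂ[X]), 1]) h
  rw [map_prod] at h1
  convert h1 using 1
  · rw [dehomog, MvPolynomial.aeval_def, MvPolynomial.aeval_def, MvPolynomial.eval₂_map,
      ← coe_mapRingHom, MvPolynomial.eval₂_comp_left (mapRingHom (Int.castRingHom ℂ))]
    congr 1
    · exact RingHom.ext_int _ _
    · ext i; fin_cases i <;> simp
  · refine Finset.prod_congr rfl fun i _ ↦ ?_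
    simp [MvPolynomial.algHom_C]

open Polynomial in
theorem exists_eq_prod_linear {n : ℕ} (hn : 1 ≤ n) (P : ℂ[X]) (hP : P.natDegree ≤ n) :
    ∃ α β : Fin n → ℂ, P = ∏ i, (C (α i) * X + C (β i)) := by
  induction n, hn using Nat.le_induction generalizing P with
  | base =>
    refine ⟨fun _ ↦ P.coeff 1, fun _ ↦ P.coeff 0, ?_⟩
    simpa using eq_X_add_C_of_natDegree_le_one hP
  | succ n hn ih =>
    rcases lt_or_ge P.natDegree (n + 1) with h | h
    · obtain ⟨α, β, h⟩ := ih P (by omega)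
      refine ⟨Fin.cons 0 α, Fin.cons 1 β, ?_⟩
      rw [Fin.prod_univ_succ]
      simpa using h
    · have h0 : P ≠ 0 := by rintro rfl; simp at h
      obtain ⟨θ, hθ⟩ := IsAlgClosed.exists_root P
        (by rw [degree_eq_natDegree h0]; norm_cast; omega)
      obtain ⟨Q, hQ⟩ := dvd_iff_isRoot.2 hθ
      have hQd : Q.natDegree ≤ n := by
        rw [hQ, natDegree_mul (X_sub_C_ne_zero _) (by rintro rfl; simp at hQ; exact h0 hQ),
          natDegree_X_sub_C] at hP
        omega
      obtain ⟨α, β, h⟩ := ih Q hQd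
      refine ⟨Fin.cons 1 α, Fin.cons (-θ) β, ?_⟩
      rw [Fin.prod_univ_succ]
      simpa [← h, ← sub_eq_add_neg] using hQ

open Polynomial in
theorem homogenize_dehomog {n : ℕ} {F : MvPolynomial (Fin 2) ℤ} (hF : F.IsHomogeneous n) :
    (dehomog F).homogenize n = F := homogenize_eq_of_isHomogeneous hF rfl

open Polynomial in
theorem natDegree_dehomog_le {n : ℕ} {F : MvPolynomial (Fin 2) ℤ} (hF : F.IsHomogeneous n) :
    (dehomog F).natDegree ≤ n := by
  rw [dehomog, MvPolynomial.aeval_def, MvPolynomial.eval₂_eq']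
  refine natDegree_sum_le_of_forall_le _ _ fun m hm ↦ ?_
  have h1 : m 0 + m 1 = n := by
    rw [← hF (MvPolynomial.mem_support_iff.1 hm), Finsupp.weight_apply,
      Finsupp.sum_fintype _ _ (by simp)]
    simp
  rw [Fin.prod_univ_two]
  simp only [Matrix.cons_val_zero, Matrix.cons_val_one, one_pow, mul_one]
  exact (natDegree_C_mul_X_pow_le _ _).trans (by omega)

open Polynomial in
theorem exists_isLinearFactorization {n : ℕ} (hn : 1 ≤ n) {F : MvPolynomial (Fin 2) ℤ}
    (hF : F.IsHomogeneous n) : ∃ α β : Fin n → ℂ, IsLinearFactorization F α β := by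
  obtain ⟨α, β, h⟩ := exists_eq_prod_linear hn ((dehomog F).map (Int.castRingHom ℂ))
    (natDegree_map_le.trans (natDegree_dehomog_le hF))
  refine ⟨α, β, ?_⟩
  have h1 := congrArg (homogenize · n) h
  rw [homogenize_map, homogenize_dehomog hF] at h1
  have h2 := homogenize_finsetProd (s := Finset.univ) (p := fun i ↦ C (α i) * X + C (β i))
    (n := fun _ ↦ 1) (fun i _ ↦ natDegree_linear_le)
  simp only [Finset.sum_const, Finset.card_univ, Fintype.card_fin, smul_eq_mul, mul_one] at h2
  rw [h2] at h1
  rw [IsLinearFactorization, h1]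
  refine Finset.prod_congr rfl fun i _ ↦ ?_
  rw [homogenize_add, homogenize_C_mul, homogenize_X one_ne_zero, homogenize_C]
  simp

/-- The right-hand side treats all roots, including the one at infinity, alike; invariance under
substitution and distinctness of the root lines are read off from it. -/
theorem formDiscr_sq_eq {n : ℕ} (hn : 2 ≤ n) {F : MvPolynomial (Fin 2) ℤ} {α β : Fin n → ℂ}
    (h : IsLinearFactorization F α β) :
    (formDiscr n F : ℂ) ^ 2 =
      (∏ i, ∏ j ∈ Finset.univ.erase i, (α i * β j - α j * β i)) ^ 2 := by
  open Polynomial in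
  have hφ : Function.Injective (Int.castRingHom ℂ) := Int.cast_injective
  have hm := h.dehomog_map
  set f := dehomog F with hf
  have hdeg : ∀ i : Fin n, (C (α i) * X + C (β i)).natDegree ≤ 1 := fun i ↦ natDegree_linear_le
  have hcn : (f.coeff n : ℂ) = ∏ i, α i := by
    have := coeff_prod_of_natDegree_le (s := Finset.univ) _ 1 fun i _ ↦ hdeg i
    rw [← hm] at this
    simpa using this
  rw [formDiscr, ← hf]
  by_cases hα : ∀ i, α i ≠ 0
  · have hc0 : f.coeff n ≠ 0 := by
      intro h0
      rw [h0, Int.cast_zero] at hcn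
      exact Finset.prod_ne_zero_iff.2 (fun i _ ↦ hα i) hcn.symm
    rw [if_pos hc0, ← eq_intCast (Int.castRingHom ℂ), ← discr_map_of_injective _ hφ
      (lt_of_lt_of_le (by omega) (le_natDegree_of_ne_zero hc0)), hm]
    have : (Finset.univ : Finset (Fin n)).Nonempty := ⟨⟨0, by omega⟩, Finset.mem_univ _⟩
    simpa using discr_sq_of_eq_prod_linear (one_ne_zero) this α β fun i _ ↦ hα i
  · push Not at hα
    obtain ⟨k, hk⟩ := hα
    have hc0 : f.coeff n = 0 := by
      rw [Finset.prod_eq_zero (Finset.mem_univ k) hk] at hcn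
      exact_mod_cast hcn
    rw [if_neg (not_not.2 hc0)]
    -- The factor `k` is the root at infinity; the remaining `n - 1` factors, with the constant `β
    -- k`, make up the dehomogenization.
    set s := (Finset.univ : Finset (Fin n)).erase k with hs
    have hscard : s.card = n - 1 := by simp [hs]
    have hm2 : f.map (Int.castRingHom ℂ) = C (β k) * ∏ i ∈ s, (C (α i) * X + C (β i)) := by
      rw [hm, ← Finset.mul_prod_erase _ _ (Finset.mem_univ k), hk]
      simp [hs]
    have hcn1 : (f.coeff (n - 1) : ℂ) = β k * ∏ i ∈ s, α i := by
      have := coeff_prod_of_natDegree_le (s := s) _ 1 fun i _ ↦ hdeg i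
      rw [← eq_intCast (Int.castRingHom ℂ), ← coeff_map, hm2, coeff_C_mul]
      congr 1
      simpa [hscard] using this
    have hsplit : ∏ i, ∏ j ∈ Finset.univ.erase i, (α i * β j - α j * β i) =
        (∏ j ∈ s, (α k * β j - α j * β k)) * ∏ i ∈ s, ((α i * β k - α k * β i) *
          ∏ j ∈ s.erase i, (α i * β j - α j * β i)) := by
      rw [← Finset.mul_prod_erase _ _ (Finset.mem_univ k), ← hs]
      congr 1
      refine Finset.prod_congr rfl fun i hi ↦ ?_
      rw [← Finset.mul_prod_erase _ _ (Finset.mem_erase.2 ⟨(Finset.mem_erase.1 hi).1.symm,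
        Finset.mem_univ k⟩), hs, Finset.erase_right_comm]
    have hsplit2 : ∏ i, ∏ j ∈ Finset.univ.erase i, (α i * β j - α j * β i) =
        (-1) ^ (n - 1) * (β k ^ (n - 1) * ∏ i ∈ s, α i) ^ 2 *
          ∏ i ∈ s, ∏ j ∈ s.erase i, (α i * β j - α j * β i) := by
      rw [hsplit, hk, Finset.prod_mul_distrib]
      simp only [zero_mul, zero_sub, sub_zero]
      rw [Finset.prod_neg, Finset.prod_mul_distrib, Finset.prod_const, hscard]
      ring
    -- This product is the coefficient of degree `n - 1`. If it vanishes, then infinity is a double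
    -- root or `F` is zero, and both sides are zero.
    by_cases hz : β k * ∏ i ∈ s, α i = 0
    · push_cast
      rw [hcn1, hz, hsplit2]
      rcases mul_eq_zero.1 hz with h | h
      · rw [h, zero_pow (n := n - 1) (by omega)]; simp
      · rw [h]; ring
    · obtain ⟨hb, hP⟩ := mul_ne_zero_iff.1 hz
      have hne : s.Nonempty := by rw [← Finset.card_pos]; omega
      have hc1 : f.coeff (n - 1) ≠ 0 := by
        intro h0
        rw [h0, Int.cast_zero] at hcn1
        exact hz hcn1.symm
      have key := discr_sq_of_eq_prod_linear hb hne α β (Finset.prod_ne_zero_iff.1 hP)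
      rw [← hm2, discr_map_of_injective _ hφ
        (lt_of_lt_of_le (by omega) (le_natDegree_of_ne_zero hc1)), hscard] at key
      push_cast
      rw [mul_pow, ← eq_intCast (Int.castRingHom ℂ) (discr f), key, hcn1, hsplit2]
      obtain ⟨m, rfl⟩ : ∃ m, n = m + 2 := ⟨n - 2, by omega⟩
      have h1 : ((-1 : ℂ) ^ (m + 2 - 1)) ^ 2 = 1 := by rw [← pow_mul, mul_comm, pow_mul]; simp
      rw [mul_pow (_ * _) (∏ i ∈ s, ∏ j ∈ s.erase i, (α i * β j - α j * β i)) 2,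
        mul_pow ((-1) ^ (m + 2 - 1)), h1, show 2 * (m + 2 - 1 - 1) = 2 * m by omega,
        show m + 2 - 1 = m + 1 by omega]
      ring

theorem linSubst_isHomogeneous {n : ℕ} {F : MvPolynomial (Fin 2) ℤ} (hF : F.IsHomogeneous n)
    (x u y v : ℤ) : (linSubst F x u y v).IsHomogeneous n := by
  have := hF.aeval (![MvPolynomial.C x * MvPolynomial.X 0 + MvPolynomial.C u * MvPolynomial.X 1,
    MvPolynomial.C y * MvPolynomial.X 0 + MvPolynomial.C v * MvPolynomial.X 1] :
      Fin 2 → MvPolynomial (Fin 2) ℤ) (n := 1) (fun i ↦ by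
    have (a b : ℤ) : (MvPolynomial.C a * MvPolynomial.X 0 + MvPolynomial.C b * MvPolynomial.X 1 :
        MvPolynomial (Fin 2) ℤ).IsHomogeneous 1 :=
      ((MvPolynomial.isHomogeneous_X _ _).C_mul _).add ((MvPolynomial.isHomogeneous_X _ _).C_mul _)
    fin_cases i
    · exact this _ _
    · exact this _ _)
  rwa [one_mul] at this

theorem aeval_linSubst {A : Type*} [CommRing A] (F : MvPolynomial (Fin 2) ℤ) (x u y v : ℤ)
    (s t : A) : MvPolynomial.aeval ![s, t] (linSubst F x u y v) =
      MvPolynomial.aeval ![(x : A) * s + u * t, y * s + v * t] F := by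
  rw [linSubst, MvPolynomial.comp_aeval_apply]
  congr 2
  ext i; fin_cases i <;> simp

open Polynomial in
theorem aeval_eq_sum_coeff_dehomog {A : Type*} [CommRing A] {n : ℕ} {F : MvPolynomial (Fin 2) ℤ}
    (hF : F.IsHomogeneous n) (s t : A) : MvPolynomial.aeval ![s, t] F =
      ∑ i ∈ Finset.range (n + 1), ((dehomog F).coeff i : A) * s ^ i * t ^ (n - i) := by
  conv_lhs => rw [← homogenize_dehomog hF]
  rw [homogenize, map_sum, Finset.Nat.sum_antidiagonal_eq_sum_range_succ_mk]
  refine Finset.sum_congr rfl fun i _ ↦ ?_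
  rw [MvPolynomial.aeval_monomial, Finsupp.prod_fintype _ _ (by simp)]
  simp [Fin.prod_univ_two, Finsupp.update_apply]
  ring

theorem aeval_int_eq_formVal (F : MvPolynomial (Fin 2) ℤ) (x y : ℤ) :
    MvPolynomial.aeval ![x, y] F = formVal F x y := by
  rw [formVal, MvPolynomial.aeval_def, MvPolynomial.eval, MvPolynomial.coe_eval₂Hom]
  rfl

theorem aeval_intCast {A : Type*} [CommRing A] (F : MvPolynomial (Fin 2) ℤ) (x y : ℤ) :
    MvPolynomial.aeval ![(x : A), (y : A)] F = (formVal F x y : A) := by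
  rw [← aeval_int_eq_formVal, ← eq_intCast (algebraMap ℤ A) (MvPolynomial.aeval _ F),
    ← MvPolynomial.aeval_algebraMap_apply]
  congr 2
  ext i; fin_cases i <;> simp

open Polynomial in
theorem dehomog_coeff_eq_formVal {n : ℕ} {F : MvPolynomial (Fin 2) ℤ}
    (hF : F.IsHomogeneous n) : (dehomog F).coeff n = formVal F 1 0 := by
  rw [← aeval_int_eq_formVal, aeval_eq_sum_coeff_dehomog hF, Finset.sum_eq_single_of_mem n (by simp)]
  · simp
  · intro i hi hin
    rw [zero_pow (by simp at hi; omega), mul_zero]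

theorem formDiscr_mem_span {n : ℕ} (hn : 3 ≤ n) {F : MvPolynomial (Fin 2) ℤ}
    (hF : F.IsHomogeneous n) : formDiscr n F ∈
      Ideal.span {(dehomog F).coeff n, (dehomog F).coeff (n - 1) ^ 2} := by
  rw [formDiscr]
  split_ifs with h
  · exact discr_mem_span_coeff _
      (le_antisymm (natDegree_dehomog_le hF) (Polynomial.le_natDegree_of_ne_zero h)) hn
  · exact Ideal.mul_mem_right _ _ (Ideal.subset_span (by simp))

/-- Each `α i * β j - α j * β i` is multiplied by the determinant of the substitution, which is 1.
The sign left open by the square is harmless for ideal membership. -/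
theorem formDiscr_linSubst_sq {n : ℕ} (hn : 2 ≤ n) {F : MvPolynomial (Fin 2) ℤ}
    (hF : F.IsHomogeneous n) {x u y v : ℤ} (hdet : x * v - u * y = 1) :
    formDiscr n (linSubst F x u y v) ^ 2 = formDiscr n F ^ 2 := by
  obtain ⟨α, β, h⟩ := exists_isLinearFactorization (by omega) hF
  have h1 := formDiscr_sq_eq hn h
  have h2 := formDiscr_sq_eq hn (h.linSubst x u y v)
  have hd : (x * v - u * y : ℂ) = 1 := by exact_mod_cast hdet
  have h3 : ∀ i j, (α i * x + β i * y) * (α j * u + β j * v) -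
      (α j * x + β j * y) * (α i * u + β i * v) = α i * β j - α j * β i := fun i j ↦ by
    linear_combination (α i * β j - α j * β i) * hd
  simp only [h3] at h2
  rw [← h1] at h2
  exact_mod_cast h2

/-- A binary form in coordinates in which a given primitive point is `(1, 0)`. -/
theorem exists_polynomial_of_det_eq_one {n : ℕ} (hn : 3 ≤ n) {F : MvPolynomial (Fin 2) ℤ}
    (hF : F.IsHomogeneous n) {x u y v : ℤ} (hdet : x * v - u * y = 1) :
    ∃ H : Polynomial ℤ, H.natDegree ≤ n ∧ H.coeff n = formVal F x y ∧
      formDiscr n F ∈ Ideal.span {H.coeff n, H.coeff (n - 1) ^ 2} ∧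
      ∀ {A : Type} [CommRing A] (s t : A),
        ∑ i ∈ Finset.range (n + 1), (H.coeff i : A) * s ^ i * t ^ (n - i) =
          MvPolynomial.aeval ![(x : A) * s + u * t, y * s + v * t] F := by
  have hG := linSubst_isHomogeneous hF x u y v
  refine ⟨dehomog (linSubst F x u y v), natDegree_dehomog_le hG, ?_, ?_, fun s t ↦ ?_⟩
  · rw [dehomog_coeff_eq_formVal hG, ← aeval_int_eq_formVal, aeval_linSubst,
      ← aeval_int_eq_formVal]
    simp
  · rcases sq_eq_sq_iff_eq_or_eq_neg.1 (formDiscr_linSubst_sq (by omega) hF hdet) with h | h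
    · rw [← h]
      exact formDiscr_mem_span hn hG
    · rw [← neg_mem_iff, ← h]
      exact formDiscr_mem_span hn hG
  · rw [← aeval_linSubst, aeval_eq_sum_coeff_dehomog hG]

/-! ### Zeros of a form modulo powers of a prime -/

theorem Int.pow_dvd_pow_mul_of_dvd_mul {p : ℤ} (hp : Prime p) {k g : ℕ} {t b : ℤ}
    (hb : ¬ p ^ (g + 1) ∣ b) (h : p ^ k ∣ t * b) : p ^ k ∣ p ^ g * t := by
  have hfin : FiniteMultiplicity p b := ⟨g, hb⟩
  obtain ⟨c, hc, hpc⟩ := hfin.exists_eq_pow_mul_and_not_dvd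
  have hle : multiplicity p b ≤ g := by
    by_contra hlt
    apply hb
    rw [hc]
    exact (pow_dvd_pow p (by omega)).trans (dvd_mul_right _ _)
  rw [hc, ← mul_assoc] at h
  have hcop : IsCoprime (p ^ k) c := ((Prime.coprime_iff_not_dvd hp).2 hpc).pow_left
  refine (hcop.dvd_of_dvd_mul_right h).trans ?_
  rw [mul_comm]
  exact mul_dvd_mul_right (pow_dvd_pow p hle) t

/-- Two primitive zeros of a form modulo `p ^ k` that are congruent modulo a fixed power of `p`
are proportional modulo almost the same power `p ^ k`. -/
theorem pow_dvd_pow_mul_det {n : ℕ} (hn : 3 ≤ n) {F : MvPolynomial (Fin 2) ℤ}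
    (hF : F.IsHomogeneous n) {p : ℤ} (hp : Prime p) {g k : ℕ} (hg : ¬ p ^ (g + 1) ∣ formDiscr n F)
    {x y x' y' : ℤ} (hxy : IsCoprime x y) (hxy' : IsCoprime x' y') (h : p ^ k ∣ formVal F x y)
    (h' : p ^ k ∣ formVal F x' y') (hdet : p ^ (g + 1) ∣ x * y' - y * x') :
    p ^ k ∣ p ^ g * (x * y' - y * x') := by
  rcases le_or_gt k g with hkg | hkg
  · exact (pow_dvd_pow p hkg).trans (dvd_mul_right _ _)
  -- In a unimodular basis starting with `(x, y)`, the point `(x', y')` has coordinates `(s, t)`,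
  -- where `t` is the determinant to be estimated.
  obtain ⟨v, w, hvw⟩ := hxy
  obtain ⟨H, -, hH0, hHD, hH⟩ := exists_polynomial_of_det_eq_one (u := -w) (v := v) hn hF
    (show x * v - -w * y = 1 by linarith)
  set t := x * y' - y * x' with ht
  set s := x' * v + w * y' with hs
  have hx' : x' = x * s + -w * t := by rw [hs, ht]; linear_combination (-x') * hvw
  have hy' : y' = y * s + v * t := by rw [hs, ht]; linear_combination (-y') * hvw
  have hsum := hH s t
  simp only [Int.cast_id] at hsum
  rw [← hx', ← hy', aeval_int_eq_formVal] at hsum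
  obtain ⟨m, rfl⟩ : ∃ m, n = m + 1 := ⟨n - 1, by omega⟩
  rw [Finset.sum_range_succ, Finset.sum_range_succ] at hsum
  have hE : t ^ 2 ∣ ∑ i ∈ Finset.range m, H.coeff i * s ^ i * t ^ (m + 1 - i) :=
    Finset.dvd_sum fun i hi ↦ Dvd.dvd.mul_left (pow_dvd_pow t
      (by have := Finset.mem_range.1 hi; omega)) _
  obtain ⟨E, hE⟩ := hE
  simp only [hE, Nat.sub_self, pow_zero, mul_one, show m + 1 - m = 1 by omega, pow_one,
    show m + 1 - 1 = m by omega] at hsum hHD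
  have hps : ¬ p ∣ s := by
    intro hps
    have hpt : p ∣ t := (dvd_pow_self p (by omega)).trans hdet
    refine hp.not_isUnit (hxy'.isUnit_of_dvd' ?_ ?_)
    · rw [hx']; exact dvd_add (hps.mul_left _) (hpt.mul_left _)
    · rw [hy']; exact dvd_add (hps.mul_left _) (hpt.mul_left _)
  have ha0 : p ^ k ∣ H.coeff (m + 1) := hH0 ▸ h
  -- Apart from the leading term, which is divisible by `p ^ k`, the value of the form is `t` times
  -- this cofactor. Since `s` is prime to `p`, divisibility of the cofactor by `p ^ (g + 1)` would
  -- pass to the second coefficient and so to the discriminant.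
  have hb : ¬ p ^ (g + 1) ∣ t * E + H.coeff m * s ^ m := by
    intro hb
    have h1 : p ^ (g + 1) ∣ H.coeff m * s ^ m := (dvd_add_right (hdet.mul_right E)).1 hb
    have h2 : p ^ (g + 1) ∣ H.coeff m := IsCoprime.dvd_of_dvd_mul_right
      (((Prime.coprime_iff_not_dvd hp).2 hps).pow_left.pow_right) h1
    obtain ⟨a, b, hab⟩ := Ideal.mem_span_pair.1 hHD
    apply hg
    rw [← hab]
    exact dvd_add (((pow_dvd_pow p hkg).trans ha0).mul_left _)
      ((h2.trans (dvd_pow_self _ two_ne_zero)).mul_left _)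
  refine Int.pow_dvd_pow_mul_of_dvd_mul hp hb ?_
  have : t * (t * E + H.coeff m * s ^ m) = formVal F x' y' - H.coeff (m + 1) * s ^ (m + 1) := by
    rw [← hsum]; ring
  rw [this]
  exact dvd_sub h' (ha0.mul_right _)

theorem aeval_smul_of_isHomogeneous {A : Type*} [CommRing A] {n : ℕ} {F : MvPolynomial (Fin 2) ℤ}
    (hF : F.IsHomogeneous n) (w s t : A) :
    MvPolynomial.aeval ![w * s, w * t] F = w ^ n * MvPolynomial.aeval ![s, t] F := by
  rw [aeval_eq_sum_coeff_dehomog hF, aeval_eq_sum_coeff_dehomog hF, Finset.mul_sum]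
  refine Finset.sum_congr rfl fun i hi ↦ ?_
  rw [mul_pow, mul_pow]
  have : w ^ n = w ^ i * w ^ (n - i) := by
    rw [← pow_add]; congr 1; have := Finset.mem_range.1 hi; omega
  rw [this]
  ring

theorem dvd_aeval_sub_aeval {A : Type*} [CommRing A] (F : MvPolynomial (Fin 2) ℤ) {d s t s' t' : A}
    (hs : d ∣ s - s') (ht : d ∣ t - t') :
    d ∣ MvPolynomial.aeval ![s, t] F - MvPolynomial.aeval ![s', t'] F := by
  rw [← Ideal.mem_span_singleton, ← Ideal.Quotient.eq] at hs ht ⊢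
  have (a b : A) : Ideal.Quotient.mk (Ideal.span {d}) (MvPolynomial.aeval ![a, b] F) =
      MvPolynomial.aeval ![Ideal.Quotient.mk (Ideal.span {d}) a,
        Ideal.Quotient.mk (Ideal.span {d}) b] F := by
    rw [← Ideal.Quotient.algebraMap_eq, ← MvPolynomial.aeval_algebraMap_apply]
    congr 2
    ext i; fin_cases i <;> simp
  rw [this, this, hs, ht]

open Polynomial in
/-- Hensel lifting of a primitive zero of a form modulo a power of `p` exceeding the one in the
discriminant. -/
theorem exists_padic_zero {n : ℕ} (hn : 3 ≤ n) {F : MvPolynomial (Fin 2) ℤ}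
    (hF : F.IsHomogeneous n) {p : ℕ} [hp : Fact p.Prime] {g : ℕ}
    (hg : ¬ (p : ℤ) ^ (g + 1) ∣ formDiscr n F)
    {x y : ℤ} (hxy : IsCoprime x y) (h : (p : ℤ) ^ (g + 1) ∣ formVal F x y) :
    ∃ ξ η : ℤ_[p], MvPolynomial.aeval ![ξ, η] F = 0 ∧ IsCoprime ξ η := by
  obtain ⟨v, w, hvw⟩ := hxy
  obtain ⟨H, hHn, hH0, hHD, hH⟩ := exists_polynomial_of_det_eq_one (u := -w) (v := v) hn hF
    (show x * v - -w * y = 1 by linarith)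
  -- The reversed polynomial is the form on the affine line through `(x, y)`, with the approximate
  -- zero at parameter 0.
  have hcoeff (i : ℕ) (hi : i ≤ n) : (H.reflect n).coeff i = H.coeff (n - i) := by
    rw [coeff_reflect, revAt_le hi]
  have hdeg : (H.reflect n).natDegree < n + 1 :=
    Nat.lt_succ_of_le ((natDegree_reflect_le).trans (by omega))
  have haeval (t : ℤ_[p]) : aeval t (H.reflect n) =
      MvPolynomial.aeval ![(x : ℤ_[p]) * 1 + (-w : ℤ) * t, y * 1 + v * t] F := by
    rw [← hH, aeval_eq_sum_range' hdeg, ← Finset.sum_range_reflect]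
    refine Finset.sum_congr rfl fun i hi ↦ ?_
    have := Finset.mem_range.1 hi
    rw [hcoeff _ (by omega)]
    simp only [zsmul_eq_mul, one_pow, mul_one]
    congr 3
    omega
  -- Hensel's condition compares the leading coefficient of `H` with the square of the next one. If
  -- it failed, `p ^ (g + 1)` would divide both and hence the discriminant.
  have hnorm : ‖aeval (0 : ℤ_[p]) (H.reflect n)‖ <
      ‖aeval (0 : ℤ_[p]) (derivative (H.reflect n))‖ ^ 2 := by
    rw [← coeff_zero_eq_aeval_zero', ← coeff_zero_eq_aeval_zero', coeff_derivative,
      hcoeff 0 (by omega), hcoeff (0 + 1) (by omega), ← norm_pow, ← map_pow]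
    simp only [Nat.sub_zero, zero_add, Nat.cast_zero, mul_one, eq_intCast]
    by_contra hle
    push Not at hle
    have h1 : (p : ℤ) ^ (g + 1) ∣ H.coeff (n - 1) ^ 2 := by
      rw [← PadicInt.norm_int_le_pow_iff_dvd]
      exact hle.trans (PadicInt.norm_int_le_pow_iff_dvd.2 (hH0 ▸ h))
    obtain ⟨a, b, hab⟩ := Ideal.mem_span_pair.1 hHD
    apply hg
    rw [← hab]
    exact dvd_add ((hH0 ▸ h).mul_left _) (h1.mul_left _)
  obtain ⟨t, ht, -⟩ := hensels_lemma hnorm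
  refine ⟨_, _, (haeval t).symm.trans ht, v, w, ?_⟩
  have : (v * x + w * y : ℤ_[p]) = 1 := by exact_mod_cast hvw
  push_cast
  linear_combination this

/-- Integer approximations to a `p`-adic zero of a form, in a chart in which it is finite. -/
theorem exists_approximate_zeros {n : ℕ} (hn : 3 ≤ n) {F : MvPolynomial (Fin 2) ℤ}
    (hF : F.IsHomogeneous n) {p : ℕ} (hp : p.Prime) {g : ℕ}
    (hg : ¬ (p : ℤ) ^ (g + 1) ∣ formDiscr n F)
    (h : HasPrimitiveSolMod F ((p : ℤ) ^ (g + 1))) :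
    ∃ c₀ : ℕ, ∀ c : ℤ, (p : ℤ) ∣ c - c₀ → ∃ ρ : ℕ → ℤ,
      (∀ k m, k ≤ m → (p : ℤ) ^ k ∣ ρ m - ρ k) ∧
      ∀ k, (p : ℤ) ^ k ∣ formVal F (ρ k) (1 - c * ρ k) := by
  have : Fact p.Prime := ⟨hp⟩
  obtain ⟨x, y, hxy, hmod⟩ := h
  obtain ⟨ξ, η, hzero, a, b, hab⟩ := exists_padic_zero hn hF hg hxy (Int.modEq_zero_iff_dvd.1 hmod)
  -- As `ξ` and `η` generate the unit ideal, one of `η`, `η + ξ` is a unit. Only the class of `c`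
  -- modulo `p` matters, which later permits one `c` for all primes.
  have hc₀ : ∃ c₀ : ℕ, IsUnit (η + c₀ * ξ) := by
    by_cases hη : IsUnit η
    · exact ⟨0, by simpa using hη⟩
    · refine ⟨1, ?_⟩
      by_contra hu
      have h1 : η ∈ nonunits ℤ_[p] := hη
      have h2 : η + (1 : ℕ) * ξ ∈ nonunits ℤ_[p] := hu
      rw [← IsLocalRing.mem_maximalIdeal] at h1 h2
      have h3 : ξ ∈ IsLocalRing.maximalIdeal ℤ_[p] := by
        have := Ideal.sub_mem _ h2 h1
        simpa using this
      have h4 : (1 : ℤ_[p]) ∈ IsLocalRing.maximalIdeal ℤ_[p] :=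
        hab ▸ Ideal.add_mem _ (Ideal.mul_mem_left _ _ h3) (Ideal.mul_mem_left _ _ h1)
      rw [IsLocalRing.mem_maximalIdeal] at h4
      exact h4 isUnit_one
  obtain ⟨c₀, hc₀⟩ := hc₀
  refine ⟨c₀, fun c hc ↦ ?_⟩
  have hunit : IsUnit (η + c * ξ) := by
    by_contra hu
    have h2 : η + c * ξ ∈ nonunits ℤ_[p] := hu
    rw [← IsLocalRing.mem_maximalIdeal] at h2
    have h3 : ((c - c₀ : ℤ) : ℤ_[p]) ∈ IsLocalRing.maximalIdeal ℤ_[p] := by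
      obtain ⟨d, hd⟩ := hc
      rw [hd, PadicInt.maximalIdeal_eq_span_p]
      push_cast
      exact Ideal.mul_mem_right _ _ (Ideal.mem_span_singleton_self _)
    have h4 : η + c₀ * ξ ∈ IsLocalRing.maximalIdeal ℤ_[p] := by
      have := Ideal.sub_mem _ h2 (Ideal.mul_mem_right ξ _ h3)
      convert this using 1
      push_cast
      ring
    rw [IsLocalRing.mem_maximalIdeal] at h4
    exact h4 hc₀
  obtain ⟨w, hw⟩ := hunit
  -- The zero is scaled so that its second coordinate plus `c` times its first is 1.
  set r : ℤ_[p] := ↑w⁻¹ * ξ with hr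
  have hr0 : MvPolynomial.aeval ![r, 1 - c * r] F = 0 := by
    have : (1 - c * r : ℤ_[p]) = ↑w⁻¹ * η := by
      have : (↑w⁻¹ * (η + c * ξ) : ℤ_[p]) = 1 := by rw [← hw]; simp
      rw [hr]; linear_combination -this
    rw [this, aeval_smul_of_isHomogeneous hF, hzero, mul_zero]
  have hspec (k : ℕ) : (p : ℤ_[p]) ^ k ∣ r - ((r.appr k : ℤ) : ℤ_[p]) := by
    have := PadicInt.appr_spec k r
    rw [Ideal.mem_span_singleton] at this
    exact_mod_cast this
  refine ⟨fun k ↦ r.appr k, fun k m hkm ↦ ?_, fun k ↦ ?_⟩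
  · rw [← PadicInt.pow_p_dvd_int_iff]
    have := dvd_sub (hspec k) ((pow_dvd_pow _ hkm).trans (hspec m))
    convert this using 1
    push_cast
    ring
  · rw [← PadicInt.pow_p_dvd_int_iff]
    have h1 := dvd_aeval_sub_aeval F (hspec k) (t := 1 - c * r)
      (t' := ((1 - c * (r.appr k : ℤ) : ℤ) : ℤ_[p])) (by
        have := (hspec k).mul_left (-c : ℤ_[p])
        convert this using 1
        push_cast
        ring)
    rw [hr0, zero_sub, aeval_intCast, dvd_neg] at h1
    exact h1

/-! ### Primitive vectors with small, highly divisible determinants -/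

/-- Integers in an interval that are pairwise congruent modulo `m`. -/
theorem card_le_of_pairwise_dvd_sub {m L : ℝ} (hm : 0 < m) (T : Finset ℤ) (d : ℤ) (hd : m ≤ d)
    (hdvd : ∀ a ∈ T, ∀ b ∈ T, d ∣ a - b) (hL : ∀ a ∈ T, ∀ b ∈ T, (a - b : ℝ) ≤ L) (hL0 : 0 ≤ L) :
    (T.card : ℝ) ≤ L / m + 1 := by
  rcases T.eq_empty_or_nonempty with rfl | hne
  · simp; positivity
  set a := T.min' hne
  have ha : a ∈ T := T.min'_mem hne
  have hdpos : 0 < d := by exact_mod_cast hm.trans_le hd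
  have hsub : T ⊆ (Finset.range (⌊L / m⌋₊ + 1)).image fun k : ℕ ↦ a + d * k := by
    intro b hb
    obtain ⟨k, hk⟩ := hdvd b hb a ha
    have hab : a ≤ b := T.min'_le b hb
    have hk0 : 0 ≤ k := by
      by_contra h
      nlinarith
    lift k to ℕ using hk0
    refine Finset.mem_image.2 ⟨k, Finset.mem_range.2 (Nat.lt_succ_of_le (Nat.le_floor ?_)), ?_⟩
    · rw [le_div_iff₀ hm]
      have h1 := hL b hb a ha
      have h2 : (b - a : ℝ) = d * k := by exact_mod_cast hk
      have h3 : m * k ≤ d * k := mul_le_mul_of_nonneg_right hd (Nat.cast_nonneg k)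
      linarith
    · linarith
  have h1 := (Finset.card_le_card hsub).trans Finset.card_image_le
  rw [Finset.card_range] at h1
  have h2 : (T.card : ℝ) ≤ ⌊L / m⌋₊ + 1 := by exact_mod_cast h1
  have := Nat.floor_le (div_nonneg hL0 hm.le)
  linarith

/-- The determinant of two integer vectors. -/
def pairDet (z w : ℤ × ℤ) : ℤ := z.1 * w.2 - z.2 * w.1

theorem exists_eq_smul_of_pairDet_eq_zero {z w : ℤ × ℤ} (hz : IsCoprime z.1 z.2)
    (h : pairDet z w = 0) : ∃ t : ℤ, w = (t * z.1, t * z.2) := by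
  obtain ⟨a, b, hab⟩ := hz
  unfold pairDet at h
  refine ⟨a * w.1 + b * w.2, Prod.ext ?_ ?_⟩ <;> simp only
  · linear_combination (-w.1) * hab - b * h
  · linear_combination (-w.2) * hab + a * h

theorem eq_or_eq_neg_of_pairDet_eq_zero {z w : ℤ × ℤ} (hz : IsCoprime z.1 z.2)
    (hw : IsCoprime w.1 w.2) (h : pairDet z w = 0) : w = z ∨ w = -z := by
  obtain ⟨t, rfl⟩ := exists_eq_smul_of_pairDet_eq_zero hz h
  have : IsUnit t := hw.isUnit_of_dvd' (dvd_mul_right _ _) (dvd_mul_right _ _)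
  rcases Int.isUnit_iff.1 this with rfl | rfl
  · left; ext <;> simp
  · right; ext <;> simp

/-- Primitive vectors whose determinants are bounded and divisible by a large number are few. -/
theorem card_primitive_le {A M : ℝ} (hM : 0 < M) (hA0 : 0 ≤ A) (T : Finset (ℤ × ℤ)) (G m : ℤ)
    (hG : 1 ≤ G) (hm : M ≤ m) (hT : ∀ z ∈ T, IsCoprime z.1 z.2)
    (hdvd : ∀ z ∈ T, ∀ w ∈ T, m ∣ G * pairDet z w)
    (hA : ∀ z ∈ T, ∀ w ∈ T, (G * |pairDet z w| : ℝ) ≤ A) :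
    (T.card : ℝ) ≤ 2 + 9 * A / M := by
  rcases T.eq_empty_or_nonempty with rfl | ⟨e, he⟩
  · simp; positivity
  -- A pair with maximal determinant `D` serves as a frame: every vector is fixed by its
  -- determinants with `z` and `w`, both at most `|D|` in absolute value.
  obtain ⟨⟨z, w⟩, hzw, hmax⟩ := (T ×ˢ T).exists_max_image (fun q ↦ |pairDet q.1 q.2|)
    ⟨(e, e), by simp [he]⟩
  simp only [Finset.mem_product, and_imp, Prod.forall] at hzw hmax
  obtain ⟨hz, hw⟩ := hzw
  set D := pairDet z w with hD
  by_cases hD0 : D = 0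
  · have : T ⊆ {e, -e} := fun u hu ↦ by
      have h1 := hmax e.1 e.2 u.1 u.2 he hu
      rw [hD0, abs_zero] at h1
      have h2 : pairDet e u = 0 := abs_nonpos_iff.1 h1
      simpa using eq_or_eq_neg_of_pairDet_eq_zero (hT e he) (hT u hu) h2
    have h2 := (Finset.card_le_card this).trans Finset.card_le_two
    have h3 : (T.card : ℝ) ≤ 2 := by exact_mod_cast h2
    have : 0 ≤ 9 * A / M := by positivity
    linarith
  have hDpos' : (0 : ℝ) < ((|D| : ℤ) : ℝ) := by exact_mod_cast abs_pos.2 hD0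
  have hGpos : (0 : ℝ) < G := by exact_mod_cast hG
  -- Vectors of one fibre differ by multiples of the primitive `z`, so their determinants with `w`
  -- differ by multiples of `D` inside an interval of length `2 |D|`.
  have hfib : ∀ k ∈ T.image (pairDet z), (T.filter fun u ↦ pairDet z u = k).card ≤ 3 := by
    intro k hk
    set S := T.filter fun u ↦ pairDet z u = k
    have hinj : Set.InjOn (fun u ↦ pairDet u w) S := by
      intro u hu v hv huv
      have h1 : pairDet z u = k := (Finset.mem_filter.1 hu).2
      have h2 : pairDet z v = k := (Finset.mem_filter.1 hv).2
      simp only at huv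
      rw [← h2] at h1
      unfold pairDet at h1 huv hD
      ext
      · apply mul_left_cancel₀ hD0
        rw [hD]
        linear_combination z.1 * huv + w.1 * h1
      · apply mul_left_cancel₀ hD0
        rw [hD]
        linear_combination z.2 * huv + w.2 * h1
    have hbd : ∀ u ∈ S, |pairDet u w| ≤ |D| := fun u hu ↦
      hmax u.1 u.2 w.1 w.2 (Finset.mem_filter.1 hu).1 hw
    have := card_le_of_pairwise_dvd_sub (L := 2 * (|D| : ℤ)) hDpos' (S.image fun u ↦ pairDet u w)
      |D| le_rfl (by
        simp only [Finset.mem_image, forall_exists_index, and_imp]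
        rintro _ u hu rfl _ v hv rfl
        rw [abs_dvd]
        have h1 : pairDet z u = k := (Finset.mem_filter.1 hu).2
        have h2 : pairDet z v = k := (Finset.mem_filter.1 hv).2
        obtain ⟨t, ht⟩ := exists_eq_smul_of_pairDet_eq_zero (w := u - v) (hT z hz) (by
          rw [← h2] at h1
          unfold pairDet at h1 ⊢
          simp only [Prod.fst_sub, Prod.snd_sub]
          linear_combination h1)
        rw [Prod.ext_iff] at ht
        simp only [Prod.fst_sub, Prod.snd_sub] at ht
        refine ⟨t, ?_⟩
        rw [hD]
        unfold pairDet
        linear_combination w.2 * ht.1 - w.1 * ht.2) (by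
        simp only [Finset.mem_image, forall_exists_index, and_imp]
        rintro _ u hu rfl _ v hv rfl
        have h1 := (abs_le.1 (hbd u hu)).2
        have h2 := (abs_le.1 (hbd v hv)).1
        have h3 : pairDet u w - pairDet v w ≤ 2 * |D| := by linarith
        exact_mod_cast h3) (by positivity)
    rw [Finset.card_image_of_injOn hinj, mul_div_cancel_right₀ _ hDpos'.ne'] at this
    have h3 : (S.card : ℝ) ≤ 3 := by linarith
    exact_mod_cast h3
  have h1 := Finset.card_le_mul_card_image (f := pairDet z) T 3 hfib
  have h2 : Function.Injective (fun k : ℤ ↦ G * k) := fun a b h ↦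
    mul_left_cancel₀ (by omega) h
  have h3 := card_le_of_pairwise_dvd_sub (L := 2 * (G * |D|)) hM ((T.image (pairDet z)).image
    fun k ↦ G * k) m hm (by
      simp only [Finset.mem_image, forall_exists_index, and_imp]
      rintro _ _ u hu rfl rfl _ _ v hv rfl rfl
      exact dvd_sub (hdvd z hz u hu) (hdvd z hz v hv)) (by
      simp only [Finset.mem_image, forall_exists_index, and_imp]
      rintro _ _ u hu rfl rfl _ _ v hv rfl rfl
      have h1 := (abs_le.1 (hmax z.1 z.2 u.1 u.2 hz hu)).2
      have h2 := (abs_le.1 (hmax z.1 z.2 v.1 v.2 hz hv)).1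
      have h3 : G * pairDet z u - G * pairDet z v ≤ 2 * (G * |D|) := by nlinarith
      exact_mod_cast h3) (by positivity)
  rw [Finset.card_image_of_injective _ h2] at h3
  have h4 : (T.card : ℝ) ≤ 3 * (T.image (pairDet z)).card := by exact_mod_cast h1
  have h5 : M ≤ G * |D| := by
    have : m ≤ G * |D| := by
      refine Int.le_of_dvd (mul_pos (by omega) (abs_pos.2 hD0)) ?_
      have := hdvd z hz w hw
      rwa [← dvd_abs, abs_mul, abs_of_pos (by omega : 0 < G)] at this
    exact hm.trans (by exact_mod_cast this)
  have h6 : G * |D| ≤ A := hA z hz w hw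
  -- As `G D` is a nonzero multiple of `m`, one has `M ≤ G |D| ≤ A`, which absorbs the summand 1.
  have h7 : 2 * (G * |D|) / M + 1 ≤ 3 * A / M := by
    rw [← div_self hM.ne', ← add_div]
    exact div_le_div_of_nonneg_right (by linarith) hM.le
  have h8 : 9 * A / M = 3 * (3 * A / M) := by ring
  linarith

/-! ### Integers composed of primes of a finite set -/

open Classical in
/-- The natural numbers in `[Y, c Y]` all of whose prime factors belong to `T`. -/
noncomputable def smoothBetween (T : Finset ℕ) (Y c : ℝ) : Finset ℕ :=
  (Finset.range (⌊c * Y⌋₊ + 1)).filter fun m ↦ m ≠ 0 ∧ m.primeFactors ⊆ T ∧ Y ≤ m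

theorem mem_smoothBetween {T : Finset ℕ} {Y c : ℝ} {m : ℕ} :
    m ∈ smoothBetween T Y c ↔ m ≠ 0 ∧ m.primeFactors ⊆ T ∧ Y ≤ m ∧ m ≤ c * Y := by
  rw [smoothBetween, Finset.mem_filter, Finset.mem_range, Nat.lt_succ_iff]
  constructor
  · rintro ⟨h1, h2, h3, h4⟩
    exact ⟨h2, h3, h4, (Nat.le_floor_iff' h2).1 h1⟩
  · rintro ⟨h1, h2, h3, h4⟩
    exact ⟨(Nat.le_floor_iff' h1).2 h4, h1, h2, h3⟩

theorem primeFactors_ordCompl_subset {p m : ℕ} {T : Finset ℕ}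
    (hm : m.primeFactors ⊆ insert p T) : (m / p ^ m.factorization p).primeFactors ⊆ T := by
  intro q hq
  have h1 : q ∈ m.primeFactors := Nat.primeFactors_mono (Nat.ordCompl_dvd m p)
    (by rintro rfl; simp at hq) hq
  rcases Finset.mem_insert.1 (hm h1) with rfl | h
  · exact absurd (Nat.dvd_of_mem_primeFactors hq) (Nat.not_dvd_ordCompl
      (Nat.prime_of_mem_primeFactors hq) (by rintro rfl; simp at h1))
  · exact h

theorem factorization_le_log_div {p m : ℕ} (hp : p.Prime) (hm : m ≠ 0) {Z : ℝ} (hZ : (m : ℝ) ≤ Z) :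
    (m.factorization p : ℝ) ≤ Real.log Z / Real.log 2 := by
  rw [le_div_iff₀ (Real.log_pos one_lt_two), ← Real.log_pow]
  apply Real.log_le_log (by positivity)
  refine le_trans ?_ hZ
  have h1 := Nat.le_of_dvd (Nat.pos_of_ne_zero hm) (Nat.ordProj_dvd m p)
  have h2 : 2 ^ m.factorization p ≤ m := (Nat.pow_le_pow_left hp.two_le _).trans h1
  exact_mod_cast h2

/-- Induction on `T`: splitting off the power of one prime leaves `O(1 + log Y)` exponents, each
costing one count for the smaller set. For a single prime the exponents lie in an interval of
bounded length, which is why the power is `T.card - 1`. -/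
theorem card_smoothBetween_le {T : Finset ℕ} (hT : ∀ p ∈ T, p.Prime) (hne : T.Nonempty) {c : ℝ}
    (hc : 1 ≤ c) : ∃ C : ℝ, 0 < C ∧ ∀ Y : ℝ, 1 ≤ Y →
      ((smoothBetween T Y c).card : ℝ) ≤ C * (1 + Real.log Y) ^ (T.card - 1) := by
  classical
  have hlog2 : 0 < Real.log 2 := Real.log_pos one_lt_two
  have hlogc : 0 ≤ Real.log c := Real.log_nonneg hc
  induction hne using Finset.Nonempty.cons_induction with
  | singleton p =>
    have hp := hT p (by simp)
    refine ⟨Real.log c / Real.log 2 + 1, by positivity, fun Y hY ↦ ?_⟩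
    simp only [Finset.card_singleton, Nat.sub_self, pow_zero, mul_one]
    have hpow : ∀ m ∈ smoothBetween {p} Y c, m = p ^ m.factorization p := fun m hm ↦ by
      rw [mem_smoothBetween] at hm
      have h1 := primeFactors_ordCompl_subset (p := p) (T := ∅) (by simpa using hm.2.1)
      rw [Finset.subset_empty, Nat.primeFactors_eq_empty] at h1
      have h2 := Nat.ordCompl_pos p hm.1
      have h3 := Nat.ordProj_mul_ordCompl_eq_self m p
      rw [h1.resolve_left h2.ne', mul_one] at h3
      exact h3.symm
    have hinj : Set.InjOn (fun m : ℕ ↦ (m.factorization p : ℤ)) (smoothBetween {p} Y c) := by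
      intro a ha b hb hab
      rw [hpow a ha, hpow b hb]
      congr 1
      exact Int.natCast_inj.1 hab
    have := card_le_of_pairwise_dvd_sub (m := 1) (L := Real.log c / Real.log 2) one_pos
      ((smoothBetween {p} Y c).image fun m : ℕ ↦ (m.factorization p : ℤ)) 1 (by simp)
      (fun _ _ _ _ ↦ one_dvd _) (by
        simp only [Finset.mem_image, forall_exists_index, and_imp]
        rintro _ a ha rfl _ b hb rfl
        have h1 := hpow a ha
        have h2 := hpow b hb
        rw [mem_smoothBetween] at ha hb
        have h3 : (a : ℝ) ≤ c * b :=
          ha.2.2.2.trans (mul_le_mul_of_nonneg_left hb.2.2.1 (by linarith))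
        have hp2 : (2 : ℝ) ≤ p := by exact_mod_cast hp.two_le
        have h1' : (a : ℝ) = p ^ a.factorization p := by exact_mod_cast h1
        have h2' : (b : ℝ) = p ^ b.factorization p := by exact_mod_cast h2
        have h4 := Real.log_le_log (by rw [h1']; positivity) h3
        rw [Real.log_mul (by linarith) (by rw [h2']; positivity), h1', h2', Real.log_pow,
          Real.log_pow] at h4
        have h5 : Real.log 2 ≤ Real.log p := Real.log_le_log two_pos hp2
        rw [le_div_iff₀ hlog2]
        push_cast
        rcases le_total (a.factorization p : ℝ) (b.factorization p) with h | h
        · nlinarith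
        · nlinarith) (by positivity)
    rw [Finset.card_image_of_injOn hinj, div_one] at this
    exact this
  | cons p T hpT hne ih =>
    have hp := hT p (by simp)
    obtain ⟨C, hC, h⟩ := ih fun q hq ↦ hT q (by simp [hq])
    refine ⟨C * ((Real.log c + 1) / Real.log 2 + 1), by positivity, fun Y hY ↦ ?_⟩
    have hlogY : 0 ≤ Real.log Y := Real.log_nonneg hY
    have hcard : (Finset.cons p T hpT).card - 1 = (T.card - 1) + 1 := by
      have := hne.card_pos
      rw [Finset.card_cons]; omega
    rw [hcard, Finset.cons_eq_insert]
    set N := ⌊Real.log (c * Y) / Real.log 2⌋₊ + 1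
    have hsub : smoothBetween (insert p T) Y c ⊆ (Finset.range N).biUnion fun a ↦
        (smoothBetween T (Y / p ^ a) c).image fun m ↦ p ^ a * m := by
      intro m hm
      rw [mem_smoothBetween] at hm
      obtain ⟨h1, h2, h3, h4⟩ := hm
      have hpa : (0 : ℝ) < p ^ m.factorization p := by have := hp.pos; positivity
      have hmul : (m : ℝ) = p ^ m.factorization p * (m / p ^ m.factorization p : ℕ) := by
        exact_mod_cast (Nat.ordProj_mul_ordCompl_eq_self m p).symm
      refine Finset.mem_biUnion.2 ⟨m.factorization p, Finset.mem_range.2 (Nat.lt_succ_of_le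
        (Nat.le_floor (factorization_le_log_div hp h1 h4))), Finset.mem_image.2
        ⟨m / p ^ m.factorization p, mem_smoothBetween.2 ⟨(Nat.ordCompl_pos p h1).ne',
          primeFactors_ordCompl_subset h2, ?_, ?_⟩, Nat.ordProj_mul_ordCompl_eq_self m p⟩⟩
      · rw [div_le_iff₀ hpa, mul_comm, ← hmul]
        exact h3
      · rw [← mul_div_assoc, le_div_iff₀ hpa, mul_comm, ← hmul]
        exact h4
    have hcard1 : ∀ a : ℕ, ((smoothBetween T (Y / p ^ a) c).card : ℝ) ≤
        C * (1 + Real.log Y) ^ (T.card - 1) := by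
      intro a
      have hpa : (1 : ℝ) ≤ p ^ a := one_le_pow₀ (by exact_mod_cast hp.one_le)
      have hYa : Y / p ^ a ≤ Y := div_le_self (by linarith) hpa
      -- When `Y / p ^ a < 1` the induction hypothesis does not apply; raising the lower end to 1
      -- loses no positive integer.
      have : ((smoothBetween T (Y / p ^ a) c).card : ℝ) ≤
          (smoothBetween T (max 1 (Y / p ^ a)) c).card := by
        refine Nat.cast_le.2 (Finset.card_le_card fun m hm ↦ ?_)
        rw [mem_smoothBetween] at hm ⊢
        refine ⟨hm.1, hm.2.1, max_le ?_ hm.2.2.1, hm.2.2.2.trans ?_⟩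
        · exact_mod_cast Nat.one_le_iff_ne_zero.2 hm.1
        · exact mul_le_mul_of_nonneg_left (le_max_right _ _) (by linarith)
      refine this.trans ((h _ (le_max_left _ _)).trans ?_)
      have h0 : 0 ≤ Real.log (max 1 (Y / p ^ a)) := Real.log_nonneg (le_max_left _ _)
      gcongr
      exact max_le hY hYa
    have h1 : ((smoothBetween (insert p T) Y c).card : ℝ) ≤
        ∑ a ∈ Finset.range N, ((smoothBetween T (Y / p ^ a) c).card : ℝ) := by
      have := (Finset.card_le_card hsub).trans (Finset.card_biUnion_le.trans
        (Finset.sum_le_sum fun a _ ↦ Finset.card_image_le))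
      exact_mod_cast this
    refine h1.trans ((Finset.sum_le_sum fun a _ ↦ hcard1 a).trans ?_)
    rw [Finset.sum_const, Finset.card_range, nsmul_eq_mul, pow_succ]
    have hN : (N : ℝ) ≤ ((Real.log c + 1) / Real.log 2 + 1) * (1 + Real.log Y) := by
      have h2 : (N : ℝ) ≤ Real.log (c * Y) / Real.log 2 + 1 := by
        have : 0 ≤ Real.log (c * Y) := Real.log_nonneg (one_le_mul_of_one_le_of_one_le hc hY)
        push_cast [N]
        gcongr
        exact Nat.floor_le (by positivity)
      rw [Real.log_mul (by linarith) (by linarith), add_div] at h2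
      have h3 : ((Real.log c + 1) / Real.log 2 + 1) * (1 + Real.log Y) =
          (Real.log c / Real.log 2 + Real.log Y / Real.log 2 + 1) + (1 / Real.log 2 +
            (Real.log c / Real.log 2) * Real.log Y + Real.log Y) := by field_simp; ring
      have h4 : 0 ≤ 1 / Real.log 2 + (Real.log c / Real.log 2) * Real.log Y + Real.log Y := by
        positivity
      linarith
    calc (N : ℝ) * (C * (1 + Real.log Y) ^ (T.card - 1))
        ≤ (((Real.log c + 1) / Real.log 2 + 1) * (1 + Real.log Y)) *
          (C * (1 + Real.log Y) ^ (T.card - 1)) := by gcongr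
      _ = _ := by ring

/-- The same induction as for the upper bound; with `c` at least each prime, `[Y, c Y]` always
contains a power of each of them. -/
theorem le_card_smoothBetween {T : Finset ℕ} (hT : ∀ p ∈ T, p.Prime) (hne : T.Nonempty) {c : ℝ}
    (hc : ∀ p ∈ T, (p : ℝ) ≤ c) : ∃ C : ℝ, 0 < C ∧ ∀ Y : ℝ, 1 ≤ Y →
      C * (1 + Real.log Y) ^ (T.card - 1) ≤ ((smoothBetween T Y c).card : ℝ) := by
  classical
  induction hne using Finset.Nonempty.cons_induction with
  | singleton p =>
    have hp := hT p (by simp)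
    refine ⟨1, one_pos, fun Y hY ↦ ?_⟩
    simp only [Finset.card_singleton, Nat.sub_self, pow_zero, mul_one]
    obtain ⟨k, hk1, hk2⟩ := exists_nat_pow_near hY (y := (p : ℝ)) (by exact_mod_cast hp.one_lt)
    have hmem : p ^ (k + 1) ∈ smoothBetween {p} Y c := by
      rw [mem_smoothBetween]
      refine ⟨pow_ne_zero _ hp.ne_zero, ?_, ?_, ?_⟩
      · rw [Nat.primeFactors_pow _ (by omega), hp.primeFactors]
      · push_cast; exact hk2.le
      · push_cast
        rw [pow_succ, mul_comm]
        exact mul_le_mul (hc p (by simp)) hk1 (by positivity)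
          ((Nat.cast_nonneg p).trans (hc p (by simp)))
    have : 1 ≤ (smoothBetween {p} Y c).card := Finset.card_pos.2 ⟨_, hmem⟩
    exact_mod_cast this
  | cons p T hpT hne ih =>
    have hp := hT p (by simp)
    obtain ⟨C, hC, h⟩ := ih (fun q hq ↦ hT q (by simp [hq])) (fun q hq ↦ hc q (by simp [hq]))
    have hp1 : (1 : ℝ) < p := by exact_mod_cast hp.one_lt
    have hlogp : 0 < Real.log p := Real.log_pos hp1
    refine ⟨C * (1 / 2) ^ (T.card - 1) / (1 + 2 * Real.log p), by positivity, fun Y hY ↦ ?_⟩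
    have hlogY : 0 ≤ Real.log Y := Real.log_nonneg hY
    have hcard : (Finset.cons p T hpT).card - 1 = (T.card - 1) + 1 := by
      have := hne.card_pos
      rw [Finset.card_cons]; omega
    rw [hcard, Finset.cons_eq_insert]
    -- Only exponents with `p ^ a ≤ √Y` are used, so that `log (Y / p ^ a)` is still at least half
    -- of `log Y`.
    set N := ⌊Real.log Y / (2 * Real.log p)⌋₊ + 1
    have hNle : 1 + Real.log Y ≤ (1 + 2 * Real.log p) * N := by
      have h1 : Real.log Y / (2 * Real.log p) ≤ N := by
        push_cast [N]; exact (Nat.lt_floor_add_one _).le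
      have h2 : (1 : ℝ) ≤ N := by
        exact_mod_cast Nat.le_add_left 1 ⌊Real.log Y / (2 * Real.log p)⌋₊
      rw [div_le_iff₀ (by positivity)] at h1
      nlinarith
    have hle : ((Finset.range N).sigma fun a ↦ smoothBetween T (Y / p ^ a) c).card ≤
        (smoothBetween (insert p T) Y c).card := by
      refine Finset.card_le_card_of_injOn (fun q ↦ p ^ q.1 * q.2) ?_ ?_
      · rintro ⟨a, m⟩ hq
        simp only [Finset.mem_coe, Finset.mem_sigma] at hq
        obtain ⟨-, hq⟩ := hq
        rw [mem_smoothBetween] at hq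
        obtain ⟨h1, h2, h3, h4⟩ := hq
        have hpa : (0 : ℝ) < p ^ a := by positivity
        rw [Finset.mem_coe, mem_smoothBetween]
        refine ⟨mul_ne_zero (pow_ne_zero _ hp.ne_zero) h1, ?_, ?_, ?_⟩
        · rw [Nat.primeFactors_mul (pow_ne_zero _ hp.ne_zero) h1]
          refine Finset.union_subset ?_ (h2.trans (Finset.subset_insert _ _))
          intro q hq
          have := (Nat.prime_dvd_prime_iff_eq (Nat.prime_of_mem_primeFactors hq) hp).1
            ((Nat.prime_of_mem_primeFactors hq).dvd_of_dvd_pow (Nat.dvd_of_mem_primeFactors hq))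
          simp [this]
        · push_cast
          rwa [div_le_iff₀' hpa] at h3
        · push_cast
          rwa [← mul_div_assoc, le_div_iff₀' hpa] at h4
      · rintro ⟨a, m⟩ hq ⟨b, l⟩ hq' heq
        simp only [Finset.mem_coe, Finset.mem_sigma] at hq hq'
        obtain ⟨-, hq⟩ := hq
        obtain ⟨-, hq'⟩ := hq'
        rw [mem_smoothBetween] at hq hq'
        simp only at heq
        have key : ∀ {m}, m ≠ 0 → m.primeFactors ⊆ T → ¬ p ∣ m := fun hm hs hd ↦
          hpT (hs (Nat.mem_primeFactors.2 ⟨hp, hd, hm⟩))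
        have h1 := key hq.1 hq.2.1
        have h2 := key hq'.1 hq'.2.1
        have h3 : m = l := by
          rw [← Nat.ordCompl_pow_mul_of_not_dvd a hp h1, heq,
            Nat.ordCompl_pow_mul_of_not_dvd b hp h2]
        subst h3
        have h4 := Nat.eq_of_mul_eq_mul_right (Nat.pos_of_ne_zero hq.1) heq
        have h5 := Nat.pow_right_injective hp.two_le h4
        subst h5
        rfl
    have hterm : ∀ a ∈ Finset.range N, C * ((1 / 2) * (1 + Real.log Y)) ^ (T.card - 1) ≤
        ((smoothBetween T (Y / p ^ a) c).card : ℝ) := by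
      intro a ha
      have ha1 : (a : ℝ) ≤ Real.log Y / (2 * Real.log p) := by
        have h1 : a ≤ ⌊Real.log Y / (2 * Real.log p)⌋₊ := Nat.lt_succ_iff.1 (Finset.mem_range.1 ha)
        exact (Nat.le_floor_iff (by positivity)).1 h1
      rw [le_div_iff₀ (by positivity)] at ha1
      have hpa : (0 : ℝ) < p ^ a := by positivity
      have hlog : Real.log (Y / p ^ a) = Real.log Y - a * Real.log p := by
        rw [Real.log_div (by linarith) hpa.ne', Real.log_pow]
      have h1 : 1 ≤ Y / p ^ a := by
        rw [← Real.log_nonneg_iff (by positivity), hlog]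
        nlinarith
      refine le_trans ?_ (h _ h1)
      rw [hlog]
      gcongr
      nlinarith
    rw [Finset.card_sigma] at hle
    have h1 : (∑ a ∈ Finset.range N, ((smoothBetween T (Y / p ^ a) c).card : ℝ)) ≤
        (smoothBetween (insert p T) Y c).card := by exact_mod_cast hle
    refine le_trans ?_ h1
    refine le_trans ?_ (Finset.sum_le_sum hterm)
    rw [Finset.sum_const, Finset.card_range, nsmul_eq_mul, mul_pow, pow_succ]
    calc C * (1 / 2) ^ (T.card - 1) / (1 + 2 * Real.log p) *
          ((1 + Real.log Y) ^ (T.card - 1) * (1 + Real.log Y))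
        ≤ C * (1 / 2) ^ (T.card - 1) / (1 + 2 * Real.log p) *
          ((1 + Real.log Y) ^ (T.card - 1) * ((1 + 2 * Real.log p) * N)) := by gcongr
      _ = _ := by field_simp

/-! ### Primitive points on a line modulo N -/

/-- Any bound below 1 would do: it lets a crude removal of all multiples of each `g ≥ 2` leave a
positive proportion of points. -/
theorem sum_Icc_two_inv_sq_le (b : ℕ) :
    ∑ g ∈ Finset.Icc 2 b, (1 / (g : ℝ) ^ 2) ≤ 3 / 4 := by
  have h : ∀ m : ℕ, ∑ g ∈ Finset.Icc 2 (m + 2), (1 / (g : ℝ) ^ 2) ≤ 3 / 4 - 1 / ((m : ℝ) + 2) := by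
    intro m
    induction m with
    | zero => norm_num
    | succ m ih =>
      rw [show m + 1 + 2 = m + 2 + 1 by omega, Finset.sum_Icc_succ_top (by omega)]
      have : 1 / (((m + 1 + 2 : ℕ) : ℝ)) ^ 2 ≤ 1 / ((m : ℝ) + 2) - 1 / ((m + 1 : ℕ) + 2) := by
        push_cast
        rw [div_sub_div _ _ (by positivity) (by positivity), div_le_div_iff₀ (by positivity)
          (by positivity)]
        nlinarith [Nat.cast_nonneg (α := ℝ) m]
      have e : m + 1 + 2 = m + 2 + 1 := by omega
      rw [e] at this
      linarith
  rcases Nat.lt_or_ge b 2 with hb | hb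
  · rw [Finset.Icc_eq_empty (by omega)]; norm_num
  · obtain ⟨m, rfl⟩ := Nat.exists_eq_add_of_le' hb
    have : 0 ≤ 1 / ((m : ℝ) + 2) := by positivity
    linarith [h m]

/-- Points of bounded height with both coordinates divisible by `g` on a line modulo `N`. -/
theorem card_multiples_le {Q N : ℕ} (hQ : 1 ≤ Q) (hN : 1 ≤ N)
    (hQN : ∀ g : ℕ, g.Coprime Q → g.Coprime N) (R : ℤ) (b : ℕ) {g : ℕ} (hg : 1 ≤ g)
    (T : Finset (ℤ × ℤ)) (hT : ∀ z ∈ T, 1 ≤ z.2 ∧ z.2 ≤ b ∧ |z.1| ≤ b ∧ (Q : ℤ) ∣ z.2 - 1 ∧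
      (N : ℤ) ∣ z.1 - R * z.2 ∧ (g : ℤ) ∣ z.1 ∧ (g : ℤ) ∣ z.2) :
    (T.card : ℝ) ≤ (2 * b / (g * N) + 1) * (b / (g * Q) + 1) := by
  have hg0 : (0 : ℝ) < g := by exact_mod_cast hg
  have hQ0 : (0 : ℝ) < Q := by exact_mod_cast hQ
  have hN0 : (0 : ℝ) < N := by exact_mod_cast hN
  rcases T.eq_empty_or_nonempty with rfl | ⟨e, he⟩
  · simp; positivity
  -- The congruence `y ≡ 1` modulo `Q` makes every common divisor of the coordinates prime to `Q`,
  -- hence to `N`, so the divisibility conditions are independent.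
  have hgQ : g.Coprime Q := by
    obtain ⟨-, -, -, h1, -, -, h2⟩ := hT e he
    rw [← Nat.isCoprime_iff_coprime]
    obtain ⟨c, hc⟩ := h1
    obtain ⟨d, hd⟩ := h2
    exact ⟨d, -c, by linear_combination hc - hd⟩
  have hgN := hQN g hgQ
  rw [← Nat.isCoprime_iff_coprime] at hgQ hgN
  have hfib : ∀ y ∈ T.image Prod.snd, (T.filter fun z ↦ z.2 = y).card ≤
      ⌊2 * (b : ℝ) / (g * N) + 1⌋₊ := by
    intro y _
    apply Nat.le_floor
    rw [← Finset.card_image_of_injOn (s := T.filter fun z ↦ z.2 = y) (f := Prod.fst)]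
    · apply card_le_of_pairwise_dvd_sub (by positivity) _ ((g : ℤ) * N) (by push_cast; rfl)
      · simp only [Finset.mem_image, Finset.mem_filter, forall_exists_index, and_imp]
        rintro _ z hz hzy rfl _ w hw hwy rfl
        obtain ⟨-, -, -, -, h1, h2, -⟩ := hT z hz
        obtain ⟨-, -, -, -, h3, h4, -⟩ := hT w hw
        refine hgN.mul_dvd (dvd_sub h2 h4) ?_
        have := dvd_sub h1 h3
        rwa [hzy, hwy, sub_sub_sub_cancel_right] at this
      · simp only [Finset.mem_image, Finset.mem_filter, forall_exists_index, and_imp]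
        rintro _ z hz hzy rfl _ w hw hwy rfl
        obtain ⟨-, -, h1, -⟩ := hT z hz
        obtain ⟨-, -, h2, -⟩ := hT w hw
        have : z.1 - w.1 ≤ 2 * b := by linarith [(abs_le.1 h1).2, (abs_le.1 h2).1]
        exact_mod_cast this
      · positivity
    · intro z hz w hw h
      exact Prod.ext h ((Finset.mem_filter.1 hz).2.trans (Finset.mem_filter.1 hw).2.symm)
  have hbase : ((T.image Prod.snd).card : ℝ) ≤ b / (g * Q) + 1 := by
    apply card_le_of_pairwise_dvd_sub (by positivity) _ ((g : ℤ) * Q) (by push_cast; rfl)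
    · simp only [Finset.mem_image, forall_exists_index, and_imp]
      rintro _ z hz rfl _ w hw rfl
      obtain ⟨-, -, -, h1, -, -, h2⟩ := hT z hz
      obtain ⟨-, -, -, h3, -, -, h4⟩ := hT w hw
      refine hgQ.mul_dvd (dvd_sub h2 h4) ?_
      have := dvd_sub h1 h3
      rwa [sub_sub_sub_cancel_right] at this
    · simp only [Finset.mem_image, forall_exists_index, and_imp]
      rintro _ z hz rfl _ w hw rfl
      obtain ⟨-, h1, -⟩ := hT z hz
      obtain ⟨h2, -⟩ := hT w hw
      have : z.2 - w.2 ≤ b := by linarith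
      exact_mod_cast this
    · positivity
  have h1 := Finset.card_le_mul_card_image (f := Prod.snd) T _ hfib
  calc (T.card : ℝ) ≤ ⌊2 * (b : ℝ) / (g * N) + 1⌋₊ * ((T.image Prod.snd).card : ℝ) := by
        exact_mod_cast h1
    _ ≤ _ := mul_le_mul (Nat.floor_le (by positivity)) hbase (by positivity) (by positivity)

/-- Primitive points of bounded height on a line modulo `N`. -/
theorem le_card_coprime {Q N : ℕ} (hQ : 1 ≤ Q) (hN : 1 ≤ N)
    (hQN : ∀ g : ℕ, g.Coprime Q → g.Coprime N) (R : ℤ) {b : ℕ} (hb : 1 ≤ b)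
    (T : Finset (ℤ × ℤ)) (hT : ∀ x y : ℤ, 1 ≤ y → y ≤ b → |x| ≤ b → (Q : ℤ) ∣ y - 1 →
      (N : ℤ) ∣ x - R * y → IsCoprime x y → (x, y) ∈ T) :
    (b : ℝ) ^ 2 / (2 * (Q * N)) - 8 * b * (1 + Real.log b) ≤ T.card := by
  have hQ0 : (0 : ℝ) < Q := by exact_mod_cast hQ
  have hN0 : (0 : ℝ) < N := by exact_mod_cast hN
  have hb0 : (1 : ℝ) ≤ b := by exact_mod_cast hb
  have hlogb : 0 ≤ Real.log b := Real.log_nonneg hb0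
  set U := b / Q
  set V := 2 * b / N
  -- The least integer `≥ -b` congruent to `R y` modulo `N`.
  let x₀ : ℤ → ℤ := fun y ↦ -b + (R * y + b) % N
  let φ : ℕ × ℕ → ℤ × ℤ := fun q ↦ (x₀ (1 + Q * q.1) + N * q.2, 1 + Q * q.1)
  have hφ : Function.Injective φ := by
    rintro ⟨u, v⟩ ⟨u', v'⟩ h
    simp only [φ, Prod.mk.injEq] at h
    have h1 : (u : ℤ) = u' := mul_left_cancel₀ (by omega : (Q : ℤ) ≠ 0) (by linarith [h.2])
    rw [h1] at h
    have h2 : (v : ℤ) = v' := mul_left_cancel₀ (by omega : (N : ℤ) ≠ 0) (by linarith [h.1])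
    ext <;> simp <;> omega
  set A := (Finset.range U ×ˢ Finset.range V).image φ with hA
  have hAcard : A.card = U * V := by
    rw [hA, Finset.card_image_of_injective _ hφ, Finset.card_product, Finset.card_range,
      Finset.card_range]
  have hAmem : ∀ z ∈ A, 1 ≤ z.2 ∧ z.2 ≤ b ∧ |z.1| ≤ b ∧ (Q : ℤ) ∣ z.2 - 1 ∧
      (N : ℤ) ∣ z.1 - R * z.2 := by
    intro z hz
    obtain ⟨⟨u, v⟩, huv, rfl⟩ := Finset.mem_image.1 hz
    simp only [Finset.mem_product, Finset.mem_range] at huv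
    obtain ⟨hu, hv⟩ := huv
    have h1 : Q * (u + 1) ≤ b := (Nat.mul_le_mul_left Q hu).trans (Nat.mul_div_le b Q)
    have h2 : N * (v + 1) ≤ 2 * b := (Nat.mul_le_mul_left N hv).trans (Nat.mul_div_le _ N)
    have h1' : (Q : ℤ) * (u + 1) ≤ b := by exact_mod_cast h1
    have h2' : (N : ℤ) * (v + 1) ≤ 2 * b := by exact_mod_cast h2
    have hQz : (1 : ℤ) ≤ Q := by exact_mod_cast hQ
    have hNz : (0 : ℤ) < N := by exact_mod_cast hN
    have h3 := Int.emod_nonneg (R * (1 + Q * u) + b) hNz.ne'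
    have h4 := Int.emod_lt_of_pos (R * (1 + Q * u) + b) hNz
    have h5 : 0 ≤ (Q : ℤ) * u := by positivity
    have h6 : 0 ≤ (N : ℤ) * v := by positivity
    simp only [φ, x₀]
    refine ⟨by linarith, by linarith, abs_le.2 ⟨by linarith, by linarith⟩, ⟨u, by ring⟩, ?_⟩
    have h7 := Int.emod_add_mul_ediv (R * (1 + Q * u) + b) N
    refine ⟨v - (R * (1 + Q * u) + b) / N, ?_⟩
    linear_combination h7
  have hcover : A ⊆ T ∪ (Finset.Icc 2 b).biUnion
      fun g ↦ A.filter fun z ↦ (g : ℤ) ∣ z.1 ∧ (g : ℤ) ∣ z.2 := by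
    intro z hz
    obtain ⟨h1, h2, h3, h4, h5⟩ := hAmem z hz
    rw [Finset.mem_union]
    by_cases hc : IsCoprime z.1 z.2
    · exact Or.inl (hT z.1 z.2 h1 h2 h3 h4 h5 hc)
    · right
      rw [Finset.mem_biUnion]
      refine ⟨Int.gcd z.1 z.2, Finset.mem_Icc.2 ⟨?_, ?_⟩, Finset.mem_filter.2
        ⟨hz, Int.gcd_dvd_left _ _, Int.gcd_dvd_right _ _⟩⟩
      · rw [Int.isCoprime_iff_gcd_eq_one] at hc
        have : Int.gcd z.1 z.2 ≠ 0 := by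
          rw [Ne, Int.gcd_eq_zero_iff]
          omega
        omega
      · have := Int.le_of_dvd (by omega) (Int.gcd_dvd_right z.1 z.2)
        omega
  have hcard : ((U * V : ℕ) : ℝ) ≤ T.card +
      ∑ g ∈ Finset.Icc 2 b, (2 * (b : ℝ) / (g * N) + 1) * (b / (g * Q) + 1) := by
    have h1 := (Finset.card_le_card hcover).trans ((Finset.card_union_le _ _).trans
      (Nat.add_le_add_left Finset.card_biUnion_le _))
    rw [hAcard] at h1
    have h2 : ((U * V : ℕ) : ℝ) ≤ T.card + ∑ g ∈ Finset.Icc 2 b,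
        ((A.filter fun z ↦ (g : ℤ) ∣ z.1 ∧ (g : ℤ) ∣ z.2).card : ℝ) := by exact_mod_cast h1
    refine h2.trans ?_
    gcongr with g hg
    refine card_multiples_le hQ hN hQN R b (by have := (Finset.mem_Icc.1 hg).1; omega) _ ?_
    intro z hz
    obtain ⟨hz1, hz2⟩ := Finset.mem_filter.1 hz
    obtain ⟨h1, h2, h3, h4, h5⟩ := hAmem z hz1
    exact ⟨h1, h2, h3, h4, h5, hz2⟩
  have hU1 : (b : ℝ) / Q ≤ U + 1 := by
    rw [div_le_iff₀ hQ0]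
    have : b < (U + 1) * Q := (Nat.div_lt_iff_lt_mul (by omega)).1 (Nat.lt_succ_self _)
    exact_mod_cast this.le
  have hV1 : (2 * b : ℝ) / N ≤ V + 1 := by
    rw [div_le_iff₀ hN0]
    have : 2 * b < (V + 1) * N := (Nat.div_lt_iff_lt_mul (by omega)).1 (Nat.lt_succ_self _)
    exact_mod_cast this.le
  have hU2 : (U : ℝ) ≤ b := by exact_mod_cast Nat.div_le_self _ _
  have hV2 : (V : ℝ) ≤ 2 * b := by exact_mod_cast Nat.div_le_self (2 * b) _
  have hUV : 2 * (b : ℝ) ^ 2 / (Q * N) - 3 * b - 1 ≤ ((U * V : ℕ) : ℝ) := by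
    have h1 : (b : ℝ) / Q * (2 * b / N) ≤ (U + 1) * (V + 1) :=
      mul_le_mul hU1 hV1 (by positivity) (by positivity)
    have h2 : (b : ℝ) / Q * (2 * b / N) = 2 * (b : ℝ) ^ 2 / (Q * N) := by field_simp
    push_cast
    nlinarith
  have hterm : ∀ g ∈ Finset.Icc 2 b, (2 * (b : ℝ) / (g * N) + 1) * (b / (g * Q) + 1) ≤
      2 * (b : ℝ) ^ 2 / (Q * N) * (1 / (g : ℝ) ^ 2) + 3 * b * (g : ℝ)⁻¹ + 1 := by
    intro g hg
    have hg0 : (0 : ℝ) < g := by have := (Finset.mem_Icc.1 hg).1; positivity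
    have h1 : (2 * (b : ℝ) / (g * N) + 1) * (b / (g * Q) + 1) =
        2 * (b : ℝ) ^ 2 / (Q * N) * (1 / (g : ℝ) ^ 2) + (2 * b / (g * N) + b / (g * Q)) + 1 := by
      field_simp; ring
    have h2 : 2 * (b : ℝ) / (g * N) ≤ 2 * b * (g : ℝ)⁻¹ := by
      rw [← div_eq_mul_inv]
      apply div_le_div_of_nonneg_left (by positivity) hg0
      exact le_mul_of_one_le_right hg0.le (by exact_mod_cast hN)
    have h3 : (b : ℝ) / (g * Q) ≤ b * (g : ℝ)⁻¹ := by
      rw [← div_eq_mul_inv]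
      apply div_le_div_of_nonneg_left (by positivity) hg0
      exact le_mul_of_one_le_right hg0.le (by exact_mod_cast hQ)
    linarith
  have hharm : ∑ g ∈ Finset.Icc 2 b, (g : ℝ)⁻¹ ≤ 1 + Real.log b := by
    have h1 := harmonic_le_one_add_log b
    rw [harmonic_eq_sum_Icc] at h1
    push_cast at h1
    refine le_trans (Finset.sum_le_sum_of_subset_of_nonneg (Finset.Icc_subset_Icc_left (by norm_num))
      fun _ _ _ ↦ by positivity) h1
  have hsum := Finset.sum_le_sum hterm
  rw [Finset.sum_add_distrib, Finset.sum_add_distrib, ← Finset.mul_sum, ← Finset.mul_sum,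
    Finset.sum_const, Nat.card_Icc, nsmul_eq_mul, mul_one] at hsum
  have h1 : ((b + 1 - 2 : ℕ) : ℝ) ≤ b := by exact_mod_cast (by omega : b + 1 - 2 ≤ b)
  have h2 : 2 * (b : ℝ) ^ 2 / (Q * N) * ∑ g ∈ Finset.Icc 2 b, (1 / (g : ℝ) ^ 2) ≤
      2 * (b : ℝ) ^ 2 / (Q * N) * (3 / 4) :=
    mul_le_mul_of_nonneg_left (sum_Icc_two_inv_sq_le b) (by positivity)
  have h3 : 3 * (b : ℝ) * ∑ g ∈ Finset.Icc 2 b, (g : ℝ)⁻¹ ≤ 3 * b * (1 + Real.log b) :=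
    mul_le_mul_of_nonneg_left hharm (by positivity)
  -- The quarter of the main term that remains after removing the share `3 / 4`.
  have h4 : (b : ℝ) ^ 2 / (2 * (Q * N)) = 2 * (b : ℝ) ^ 2 / (Q * N) * (1 / 4) := by
    field_simp; norm_num
  have h5 : 0 ≤ (b : ℝ) * Real.log b := by positivity
  nlinarith

/-! ### Real size of the form and points in a dyadic shell -/

theorem IsLinearFactorization.det_ne_zero {n : ℕ} (hn : 2 ≤ n) {F : MvPolynomial (Fin 2) ℤ}
    {α β : Fin n → ℂ} (h : IsLinearFactorization F α β) (hD : formDiscr n F ≠ 0) {i j : Fin n}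
    (hij : i ≠ j) : α i * β j - α j * β i ≠ 0 := by
  have h1 := formDiscr_sq_eq hn h
  have h2 : ∏ i, ∏ j ∈ Finset.univ.erase i, (α i * β j - α j * β i) ≠ 0 := by
    intro h0
    rw [h0, zero_pow two_ne_zero] at h1
    exact hD (by exact_mod_cast (pow_eq_zero_iff two_ne_zero).1 h1)
  rw [Finset.prod_ne_zero_iff] at h2
  exact Finset.prod_ne_zero_iff.1 (h2 i (Finset.mem_univ i)) j
    (Finset.mem_erase.2 ⟨hij.symm, Finset.mem_univ j⟩)

theorem exists_abs_formVal_le {n : ℕ} (hn : 1 ≤ n) {F : MvPolynomial (Fin 2) ℤ}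
    (hF : F.IsHomogeneous n) : ∃ C : ℝ, 1 ≤ C ∧ ∀ (x y : ℤ) (R : ℝ), |(x : ℝ)| ≤ R → |(y : ℝ)| ≤ R →
      |(formVal F x y : ℝ)| ≤ C * R ^ n := by
  obtain ⟨α, β, h⟩ := exists_isLinearFactorization hn hF
  refine ⟨∏ i, (1 + ‖α i‖ + ‖β i‖), ?_, fun x y R hx hy ↦ ?_⟩
  · calc (1 : ℝ) = ∏ i : Fin n, (1 : ℝ) := by simp
      _ ≤ _ := Finset.prod_le_prod (fun _ _ ↦ zero_le_one) fun i _ ↦ by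
        linarith [norm_nonneg (α i), norm_nonneg (β i)]
  · have hR : 0 ≤ R := (abs_nonneg _).trans hx
    have h1 : |(formVal F x y : ℝ)| = ‖(formVal F x y : ℂ)‖ := by
      rw [Complex.norm_intCast]
    rw [h1, h.formVal_eq, norm_prod]
    calc ∏ i, ‖α i * x + β i * y‖ ≤ ∏ i, (1 + ‖α i‖ + ‖β i‖) * R := by
          refine Finset.prod_le_prod (fun _ _ ↦ norm_nonneg _) fun i _ ↦ ?_
          refine (norm_add_le _ _).trans ?_
          rw [norm_mul, norm_mul, Complex.norm_intCast, Complex.norm_intCast]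
          have := mul_le_mul_of_nonneg_left hx (norm_nonneg (α i))
          have := mul_le_mul_of_nonneg_left hy (norm_nonneg (β i))
          linarith
      _ = _ := by rw [Finset.prod_mul_distrib]; simp

/-- Points near the same root line of a form have small determinants. -/
theorem exists_coloring {n : ℕ} (hn : 2 ≤ n) {F : MvPolynomial (Fin 2) ℤ}
    (hF : F.IsHomogeneous n) (hD : formDiscr n F ≠ 0) :
    ∃ (κ : ℤ × ℤ → Fin n) (C : ℝ), 0 < C ∧
      (∀ z w, κ z = κ w → formVal F z.1 z.2 = 0 → formVal F w.1 w.2 = 0 → pairDet z w = 0) ∧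
      ∀ (R V : ℝ) (z w : ℤ × ℤ), κ z = κ w → 0 < R →
        R / 2 ≤ max |(z.1 : ℝ)| |(z.2 : ℝ)| → max |(z.1 : ℝ)| |(z.2 : ℝ)| ≤ R →
        R / 2 ≤ max |(w.1 : ℝ)| |(w.2 : ℝ)| → max |(w.1 : ℝ)| |(w.2 : ℝ)| ≤ R →
        |(formVal F z.1 z.2 : ℝ)| ≤ V → |(formVal F w.1 w.2 : ℝ)| ≤ V →
        |(pairDet z w : ℝ)| ≤ C * (V * R ^ 2 / R ^ n) := by
  obtain ⟨α, β, h⟩ := exists_isLinearFactorization (by omega) hF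
  have : Nontrivial (Fin n) := Fin.nontrivial_iff_two_le.2 hn
  have : NeZero n := ⟨by omega⟩
  let ℓ : Fin n → ℤ × ℤ → ℂ := fun i z ↦ α i * z.1 + β i * z.2
  -- The colour of a point is the index of a linear factor that is smallest there.
  have hex : ∀ z, ∃ i, ∀ j, ‖ℓ i z‖ ≤ ‖ℓ j z‖ := fun z ↦ by
    obtain ⟨i, -, hi⟩ := Finset.exists_min_image Finset.univ (fun i ↦ ‖ℓ i z‖) ⟨0, Finset.mem_univ _⟩
    exact ⟨i, fun j ↦ hi j (Finset.mem_univ j)⟩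
  choose κ hκ using hex
  have hprod : ∀ z : ℤ × ℤ, |(formVal F z.1 z.2 : ℝ)| = ∏ i, ‖ℓ i z‖ := fun z ↦ by
    have h1 : |(formVal F z.1 z.2 : ℝ)| = ‖(formVal F z.1 z.2 : ℂ)‖ := by
      rw [Complex.norm_intCast]
    rw [h1, h.formVal_eq, norm_prod]
  have hdet : ∀ i (z w : ℤ × ℤ), (‖α i‖ + ‖β i‖) * |(pairDet z w : ℝ)| ≤
      ‖ℓ i z‖ * (|(w.1 : ℝ)| + |(w.2 : ℝ)|) + ‖ℓ i w‖ * (|(z.1 : ℝ)| + |(z.2 : ℝ)|) := by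
    intro i z w
    have h1 : α i * (pairDet z w : ℤ) = ℓ i z * w.2 - ℓ i w * z.2 := by
      simp only [ℓ, pairDet]; push_cast; ring
    have h2 : β i * (pairDet z w : ℤ) = ℓ i w * z.1 - ℓ i z * w.1 := by
      simp only [ℓ, pairDet]; push_cast; ring
    have h1' := congrArg norm h1
    have h2' := congrArg norm h2
    rw [norm_mul, Complex.norm_intCast] at h1' h2'
    rw [add_mul, h1', h2']
    refine (add_le_add (norm_sub_le _ _) (norm_sub_le _ _)).trans (le_of_eq ?_)
    simp only [norm_mul, Complex.norm_intCast]
    ring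
  obtain ⟨δ, hδ, hδle⟩ : ∃ δ : ℝ, 0 < δ ∧ ∀ i j, i ≠ j → δ ≤ ‖α i * β j - α j * β i‖ := by
    obtain ⟨i₀, j₀, hij⟩ := exists_pair_ne (Fin n)
    obtain ⟨q, hq, hmin⟩ := Finset.exists_min_image
      ((Finset.univ : Finset (Fin n × Fin n)).filter fun q ↦ q.1 ≠ q.2)
      (fun q ↦ ‖α q.1 * β q.2 - α q.2 * β q.1‖) ⟨(i₀, j₀), by simpa using hij⟩
    exact ⟨_, norm_pos_iff.2 (h.det_ne_zero hn hD (Finset.mem_filter.1 hq).2), fun i j hij ↦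
      hmin (i, j) (by simpa using hij)⟩
  set E := ∑ i, (‖α i‖ + ‖β i‖) with hE
  have hEle : ∀ i, ‖α i‖ + ‖β i‖ ≤ E := fun i ↦
    Finset.single_le_sum (f := fun i ↦ ‖α i‖ + ‖β i‖) (fun i _ ↦ by positivity) (Finset.mem_univ i)
  have hαβ : ∀ i, δ ≤ (‖α i‖ + ‖β i‖) * E := by
    intro i
    obtain ⟨j, hj⟩ := exists_ne i
    refine (hδle i j hj.symm).trans ((norm_sub_le _ _).trans ?_)
    rw [norm_mul, norm_mul]
    refine le_trans ?_ (mul_le_mul_of_nonneg_left (hEle j) (by positivity))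
    nlinarith [norm_nonneg (α i), norm_nonneg (β i), norm_nonneg (α j), norm_nonneg (β j)]
  have hE0 : 0 < E := by
    by_contra hE1
    have := hαβ 0
    have h0 : 0 ≤ ‖α 0‖ + ‖β 0‖ := by positivity
    nlinarith [hEle 0]
  set K := E / δ with hK
  have hK0 : 0 < K := by positivity
  have hKαβ : ∀ i, 1 ≤ K * (‖α i‖ + ‖β i‖) := fun i ↦ by
    rw [hK, div_mul_eq_mul_div, le_div_iff₀ hδ, one_mul, mul_comm]
    exact hαβ i
  -- Cramer's rule: two distinct linear factors cannot both be small compared with the height.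
  have hfar : ∀ i j, i ≠ j → ∀ z : ℤ × ℤ,
      max |(z.1 : ℝ)| |(z.2 : ℝ)| ≤ K * (‖ℓ i z‖ + ‖ℓ j z‖) := by
    intro i j hij z
    have h1 : (α i * β j - α j * β i) * z.1 = β j * ℓ i z - β i * ℓ j z := by
      simp only [ℓ]; ring
    have h2 : (α i * β j - α j * β i) * z.2 = α i * ℓ j z - α j * ℓ i z := by
      simp only [ℓ]; ring
    have h1' := congrArg norm h1
    have h2' := congrArg norm h2
    rw [norm_mul, Complex.norm_intCast] at h1' h2'
    have h3 := norm_sub_le (β j * ℓ i z) (β i * ℓ j z)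
    have h4 := norm_sub_le (α i * ℓ j z) (α j * ℓ i z)
    rw [norm_mul, norm_mul] at h3 h4
    have hi := hEle i
    have hj := hEle j
    have a1 := norm_nonneg (α i)
    have a2 := norm_nonneg (β i)
    have a3 := norm_nonneg (α j)
    have a4 := norm_nonneg (β j)
    have a5 := norm_nonneg (ℓ i z)
    have a6 := norm_nonneg (ℓ j z)
    rw [hK, div_mul_eq_mul_div, le_div_iff₀ hδ, max_mul_of_nonneg _ _ hδ.le]
    apply max_le
    · have h5 := mul_le_mul_of_nonneg_left (hδle i j hij) (abs_nonneg (z.1 : ℝ))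
      have h6 : ‖β j‖ * ‖ℓ i z‖ ≤ E * ‖ℓ i z‖ := by gcongr; linarith
      have h7 : ‖β i‖ * ‖ℓ j z‖ ≤ E * ‖ℓ j z‖ := by gcongr; linarith
      linarith
    · have h5 := mul_le_mul_of_nonneg_left (hδle i j hij) (abs_nonneg (z.2 : ℝ))
      have h6 : ‖α j‖ * ‖ℓ i z‖ ≤ E * ‖ℓ i z‖ := by gcongr; linarith
      have h7 : ‖α i‖ * ‖ℓ j z‖ ≤ E * ‖ℓ j z‖ := by gcongr; linarith
      linarith
  -- By `hfar` each of the `n - 1` other factors is at least `R / (4 K)`, so the smallest one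
  -- carries the whole saving.
  have hnear : ∀ (R V : ℝ) (z : ℤ × ℤ), 0 < R → R / 2 ≤ max |(z.1 : ℝ)| |(z.2 : ℝ)| →
      |(formVal F z.1 z.2 : ℝ)| ≤ V → ‖ℓ (κ z) z‖ * (R / (4 * K)) ^ (n - 1) ≤ V := by
    intro R V z hR hz hV
    rw [hprod, ← Finset.mul_prod_erase _ _ (Finset.mem_univ (κ z))] at hV
    refine le_trans ?_ hV
    have hc : ((Finset.univ : Finset (Fin n)).erase (κ z)).card = n - 1 := by simp
    rw [← hc, ← Finset.prod_const]
    refine mul_le_mul_of_nonneg_left (Finset.prod_le_prod (fun _ _ ↦ by positivity) fun j hj ↦ ?_)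
      (norm_nonneg _)
    have h1 := hfar (κ z) j (Finset.mem_erase.1 hj).1.symm z
    have h2 := hκ z j
    rw [div_le_iff₀ (by positivity)]
    nlinarith
  refine ⟨κ, (4 * K) ^ n, by positivity, fun z w hzw hz hw ↦ ?_,
    fun R V z w hzw hR hz1 hz2 hw1 hw2 hzV hwV ↦ ?_⟩
  · have hzero : ∀ z : ℤ × ℤ, formVal F z.1 z.2 = 0 → ℓ (κ z) z = 0 := by
      intro z hz
      have h1 := hprod z
      rw [hz, Int.cast_zero, abs_zero] at h1
      obtain ⟨j, -, hj⟩ := Finset.prod_eq_zero_iff.1 h1.symm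
      have := hκ z j
      rw [hj] at this
      exact norm_eq_zero.1 (le_antisymm this (norm_nonneg _))
    have h1 := hdet (κ z) z w
    rw [hzero z hz, hzw, hzero w hw] at h1
    simp only [norm_zero, zero_mul, add_zero] at h1
    have h2 := hKαβ (κ w)
    have h3 : 0 < ‖α (κ w)‖ + ‖β (κ w)‖ := by
      by_contra h4
      nlinarith
    have h4 : |(pairDet z w : ℝ)| ≤ 0 := by
      by_contra h5
      nlinarith
    exact_mod_cast abs_nonpos_iff.1 h4
  · have h1 := hdet (κ z) z w
    have h2 := hnear R V z hR hz1 hzV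
    have h3 := hnear R V w hR hw1 hwV
    rw [← hzw] at h3
    obtain ⟨hz3, hz4⟩ := max_le_iff.1 hz2
    obtain ⟨hw3, hw4⟩ := max_le_iff.1 hw2
    set a := ‖ℓ (κ z) z‖
    set b := ‖ℓ (κ z) w‖
    have ha : 0 ≤ a := norm_nonneg _
    have hb : 0 ≤ b := norm_nonneg _
    set P := (R / (4 * K)) ^ (n - 1) with hP
    have hP0 : 0 < P := by positivity
    have h4 : a * (|(w.1 : ℝ)| + |(w.2 : ℝ)|) ≤ a * (2 * R) := by gcongr; linarith
    have h5 : b * (|(z.1 : ℝ)| + |(z.2 : ℝ)|) ≤ b * (2 * R) := by gcongr; linarith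
    have h6 : |(pairDet z w : ℝ)| ≤ K * ((a + b) * (2 * R)) := by
      calc |(pairDet z w : ℝ)| ≤ K * (‖α (κ z)‖ + ‖β (κ z)‖) * |(pairDet z w : ℝ)| :=
            le_mul_of_one_le_left (abs_nonneg _) (hKαβ _)
        _ = K * ((‖α (κ z)‖ + ‖β (κ z)‖) * |(pairDet z w : ℝ)|) := by ring
        _ ≤ K * ((a + b) * (2 * R)) :=
            mul_le_mul_of_nonneg_left (h1.trans (by linarith)) hK0.le
    have h7 : |(pairDet z w : ℝ)| * P ≤ 4 * K * R * V := by
      calc |(pairDet z w : ℝ)| * P ≤ K * ((a + b) * (2 * R)) * P := by gcongr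
        _ = 2 * K * R * (a * P + b * P) := by ring
        _ ≤ 2 * K * R * (V + V) := by gcongr
        _ = _ := by ring
    rw [← le_div_iff₀ hP0] at h7
    refine h7.trans (le_of_eq ?_)
    obtain ⟨m, rfl⟩ : ∃ m, n = m + 1 := ⟨n - 1, by omega⟩
    have hL : 0 < 4 * K := by positivity
    rw [hP, show m + 1 - 1 = m by omega, div_pow]
    generalize 4 * K = L at hL
    field_simp
    ring

theorem card_primitive_zeros_le {n : ℕ} (hn : 2 ≤ n) {F : MvPolynomial (Fin 2) ℤ}
    (hF : F.IsHomogeneous n) (hD : formDiscr n F ≠ 0) (T : Finset (ℤ × ℤ))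
    (hT : ∀ z ∈ T, IsCoprime z.1 z.2 ∧ formVal F z.1 z.2 = 0) : T.card ≤ 2 * n := by
  obtain ⟨κ, C, -, hκ, -⟩ := exists_coloring hn hF hD
  have := Finset.card_le_mul_card_image_of_maps_to (f := κ) (s := T) (t := Finset.univ)
    (fun _ _ ↦ Finset.mem_univ _) 2 fun i _ ↦ by
      rcases (T.filter fun z ↦ κ z = i).eq_empty_or_nonempty with h | ⟨e, he⟩
      · rw [h]; simp
      · have : (T.filter fun z ↦ κ z = i) ⊆ {e, -e} := fun u hu ↦ by
          rw [Finset.mem_filter] at he hu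
          simpa using eq_or_eq_neg_of_pairDet_eq_zero (hT e he.1).1 (hT u hu.1).1
            (hκ e u (he.2.trans hu.2.symm) (hT e he.1).2 (hT u hu.1).2)
        exact (Finset.card_le_card this).trans Finset.card_le_two
  simpa using this

/-- The number of primitive points in a dyadic shell at which the form is bounded by `V` and
divisible by `M`. -/
theorem exists_card_shell_le {n : ℕ} (hn : 3 ≤ n) {F : MvPolynomial (Fin 2) ℤ}
    (hF : F.IsHomogeneous n) (hD : formDiscr n F ≠ 0) (S : Finset ℕ) (hS : ∀ p ∈ S, p.Prime) :
    ∃ C : ℝ, 0 < C ∧ ∀ (R V : ℝ) (M : ℕ) (T : Finset (ℤ × ℤ)), 0 < R → 0 ≤ V → M ≠ 0 →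
      M.primeFactors ⊆ S → (∀ z ∈ T, IsCoprime z.1 z.2 ∧ R / 2 ≤ max |(z.1 : ℝ)| |(z.2 : ℝ)| ∧
        max |(z.1 : ℝ)| |(z.2 : ℝ)| ≤ R ∧ |(formVal F z.1 z.2 : ℝ)| ≤ V ∧
        (M : ℤ) ∣ formVal F z.1 z.2) →
      (T.card : ℝ) ≤ C * (1 + V * R ^ 2 / R ^ n / M) := by
  obtain ⟨κ, C, hC, -, hκ⟩ := exists_coloring (by omega) hF hD
  set G := |formDiscr n F| with hG
  have hG1 : 1 ≤ G := Int.one_le_abs hD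
  have hG0 : (0 : ℝ) < G := by exact_mod_cast hG1
  -- `Q` is divisible by `p ^ (g_p + 1)` for all `p ∈ S`, so points congruent modulo `Q` meet the
  -- determinant hypothesis of `pow_dvd_pow_mul_det`. The losses `p ^ g_p` are together absorbed by
  -- the factor `G`.
  set Q := (formDiscr n F).natAbs * ∏ p ∈ S, p with hQ
  have hQ0 : Q ≠ 0 := mul_ne_zero (Int.natAbs_ne_zero.2 hD)
    (Finset.prod_ne_zero_iff.2 fun p hp ↦ (hS p hp).ne_zero)
  have : NeZero Q := ⟨hQ0⟩
  refine ⟨(2 + 9 * (G * C)) * (n * (Q * Q)), by positivity, fun R V M T hR hV hM hMS hT ↦ ?_⟩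
  have hM0 : (0 : ℝ) < M := by positivity
  let f : ℤ × ℤ → Fin n × ZMod Q × ZMod Q := fun z ↦ (κ z, z.1, z.2)
  set A := G * (C * (V * R ^ 2 / R ^ n)) with hA
  have hA0 : 0 ≤ A := by positivity
  have hfib : ∀ i ∈ (Finset.univ : Finset (Fin n × ZMod Q × ZMod Q)),
      (T.filter fun z ↦ f z = i).card ≤ ⌊2 + 9 * A / M⌋₊ := by
    intro i _
    apply Nat.le_floor
    refine card_primitive_le hM0 hA0 _ G M hG1 (by simp) ?_ ?_ ?_
    · intro z hz
      exact (hT z (Finset.mem_filter.1 hz).1).1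
    · intro z hz w hw
      rw [Finset.mem_filter] at hz hw
      have hzw := hz.2.trans hw.2.symm
      simp only [f, Prod.mk.injEq, ZMod.intCast_eq_intCast_iff_dvd_sub] at hzw
      obtain ⟨-, h1, h2⟩ := hzw
      obtain ⟨hzc, -, -, -, hzM⟩ := hT z hz.1
      obtain ⟨hwc, -, -, -, hwM⟩ := hT w hw.1
      rw [Int.natCast_dvd, Nat.dvd_iff_prime_pow_dvd_dvd]
      intro p k hp hk
      rcases Nat.eq_zero_or_pos k with rfl | hk0
      · simp
      have : Fact p.Prime := ⟨hp⟩
      have hpS : p ∈ S := hMS (Nat.mem_primeFactors.2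
        ⟨hp, (dvd_pow_self p hk0.ne').trans hk, hM⟩)
      have hkM : (p : ℤ) ^ k ∣ M := by exact_mod_cast hk
      have hgD : (p : ℤ) ^ padicValInt p (formDiscr n F) ∣ formDiscr n F := padicValInt_dvd _
      have hpg : ¬ (p : ℤ) ^ (padicValInt p (formDiscr n F) + 1) ∣ formDiscr n F := by
        rw [padicValInt_dvd_iff]
        simp [hD]
      have hQp : (p : ℤ) ^ (padicValInt p (formDiscr n F) + 1) ∣ Q := by
        rw [hQ, pow_succ]
        push_cast
        refine mul_dvd_mul ((dvd_abs _ _).2 hgD) ?_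
        exact Finset.dvd_prod_of_mem (fun p : ℕ ↦ (p : ℤ)) hpS
      have hdet : (p : ℤ) ^ (padicValInt p (formDiscr n F) + 1) ∣ z.1 * w.2 - z.2 * w.1 := by
        have : z.1 * w.2 - z.2 * w.1 = z.1 * (w.2 - z.2) - z.2 * (w.1 - z.1) := by ring
        rw [this]
        exact dvd_sub ((hQp.trans h2).mul_left _) ((hQp.trans h1).mul_left _)
      have key := pow_dvd_pow_mul_det hn hF (Nat.prime_iff_prime_int.1 hp) hpg hzc hwc
        (hkM.trans hzM) (hkM.trans hwM) hdet
      have : (p : ℤ) ^ k ∣ G * pairDet z w :=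
        key.trans (mul_dvd_mul_right ((dvd_abs _ _).2 hgD) _)
      rw [← Int.natCast_dvd]
      exact_mod_cast this
    · intro z hz w hw
      rw [Finset.mem_filter] at hz hw
      have hzw := congrArg Prod.fst (hz.2.trans hw.2.symm)
      obtain ⟨-, h1, h2, h3, -⟩ := hT z hz.1
      obtain ⟨-, h4, h5, h6, -⟩ := hT w hw.1
      exact mul_le_mul_of_nonneg_left (by
        have := hκ R V z w hzw hR h1 h2 h4 h5 h3 h6
        exact_mod_cast this) hG0.le
  have h1 := Finset.card_le_mul_card_image_of_maps_to (f := f) (s := T) (t := Finset.univ)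
    (fun _ _ ↦ Finset.mem_univ _) _ hfib
  simp only [Finset.card_univ, Fintype.card_prod, Fintype.card_fin, ZMod.card] at h1
  have h2 : (T.card : ℝ) ≤ ⌊2 + 9 * A / M⌋₊ * (n * (Q * Q)) := by exact_mod_cast h1
  refine h2.trans ?_
  have h3 : (⌊2 + 9 * A / M⌋₊ : ℝ) ≤ 2 + 9 * A / M := Nat.floor_le (by positivity)
  have h4 : 2 + 9 * A / M ≤ (2 + 9 * (G * C)) * (1 + V * R ^ 2 / R ^ n / M) := by
    have h5 : 9 * A / M = 9 * (G * C) * (V * R ^ 2 / R ^ n / M) := by rw [hA]; ring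
    have h6 : 0 ≤ V * R ^ 2 / R ^ n / M := by positivity
    have h7 : 0 ≤ 9 * (G * C) := by positivity
    rw [h5]
    nlinarith
  calc (⌊2 + 9 * A / M⌋₊ : ℝ) * (n * (Q * Q))
      ≤ (2 + 9 * (G * C)) * (1 + V * R ^ 2 / R ^ n / M) * (n * (Q * Q)) := by
        gcongr; exact h3.trans h4
    _ = _ := by ring

/-! ### The upper bound -/

open Classical in
/-- The primes `p ∈ S` counted by `numSolvablePrimes`. -/
noncomputable def solvablePrimes (n : ℕ) (F : MvPolynomial (Fin 2) ℤ) (S : Finset ℕ) : Finset ℕ :=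
  S.filter fun p : ℕ => HasPrimitiveSolMod F ((p : ℤ) ^ (padicValInt p (formDiscr n F) + 1))

theorem card_solvablePrimes (n : ℕ) (F : MvPolynomial (Fin 2) ℤ) (S : Finset ℕ) :
    (solvablePrimes n F S).card = numSolvablePrimes n F S := rfl

theorem solvablePrimes_subset (n : ℕ) (F : MvPolynomial (Fin 2) ℤ) (S : Finset ℕ) :
    solvablePrimes n F S ⊆ S := by
  classical
  exact fun _ hp ↦ (Finset.mem_filter.1 hp).1

theorem primeFactors_prod_pow_subset {T : Finset ℕ} (hT : ∀ p ∈ T, p.Prime) (e : ℕ → ℕ) :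
    (∏ p ∈ T, p ^ e p).primeFactors ⊆ T := by
  intro q hq
  have hqp := Nat.prime_of_mem_primeFactors hq
  obtain ⟨p, hp, hqp'⟩ := (hqp.prime.dvd_finsetProd_iff _).1 (Nat.dvd_of_mem_primeFactors hq)
  rw [(Nat.prime_dvd_prime_iff_eq hqp (hT p hp)).1 (hqp.dvd_of_dvd_pow hqp')]
  exact hp

theorem prod_pow_padicValInt_dvd {T : Finset ℕ} (hT : ∀ p ∈ T, p.Prime) (m : ℤ) :
    ((∏ p ∈ T, p ^ padicValInt p m : ℕ) : ℤ) ∣ m := by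
  push_cast
  refine Finset.prod_dvd_of_coprime (fun p hp q hq hpq ↦ ?_) fun p hp ↦ ?_
  · have := (Nat.coprime_primes (hT p hp) (hT q hq)).2 hpq
    exact (Nat.isCoprime_iff_coprime.2 this).pow
  · exact padicValInt_dvd _

/-- Up to a constant the `S`-part of a value at a primitive point comes from the solvable primes. -/
theorem sPart_le_mul_prod {n : ℕ} {F : MvPolynomial (Fin 2) ℤ} {S : Finset ℕ}
    (hS : ∀ p ∈ S, p.Prime) {x y : ℤ} (hxy : IsCoprime x y) :
    sPart S (formVal F x y) ≤ (∏ p ∈ S, p ^ padicValInt p (formDiscr n F)) *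
      ∏ p ∈ solvablePrimes n F S, p ^ padicValInt p (formVal F x y) := by
  classical
  rw [sPart, ← Finset.prod_sdiff (solvablePrimes_subset n F S)]
  refine Nat.mul_le_mul_right _ ?_
  refine (Finset.prod_le_prod' (g := fun p ↦ p ^ padicValInt p (formDiscr n F))
    fun p hp ↦ ?_).trans ?_
  · obtain ⟨hpS, hps⟩ := Finset.mem_sdiff.1 hp
    have : Fact p.Prime := ⟨hS p hpS⟩
    refine Nat.pow_le_pow_right (hS p hpS).pos ?_
    by_contra hlt
    apply hps
    refine Finset.mem_filter.2 ⟨hpS, x, y, hxy, Int.modEq_zero_iff_dvd.2 ?_⟩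
    rw [padicValInt_dvd_iff]
    exact Or.inr (by omega)
  · exact Finset.prod_le_prod_of_subset_of_one_le' Finset.sdiff_subset fun p hp _ ↦
      Nat.one_le_pow _ _ (hS p hp).pos

/-- A large smooth number has a smooth divisor in a prescribed range. -/
theorem exists_dvd_mem_smoothBetween {T : Finset ℕ} {c Y : ℝ} (hc1 : 1 ≤ c)
    (hc : ∀ p ∈ T, (p : ℝ) ≤ c) (hY : 1 ≤ Y) {M : ℕ} (hM0 : M ≠ 0) (hM : M.primeFactors ⊆ T)
    (hYM : Y ≤ M) : ∃ m ∈ smoothBetween T Y c, m ∣ M := by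
  classical
  -- The smallest divisor `≥ Y`: dividing it by one prime, at most `c`, falls below `Y`.
  obtain ⟨m, hm, hmin⟩ := (M.divisors.filter fun m : ℕ ↦ Y ≤ (m : ℝ)).exists_min_image id
    ⟨M, by simp [hM0, hYM]⟩
  simp only [Finset.mem_filter, Nat.mem_divisors, id] at hm hmin
  obtain ⟨⟨hmM, -⟩, hYm⟩ := hm
  have hm0 : m ≠ 0 := by rintro rfl; simp at hYm; linarith
  have hmT : m.primeFactors ⊆ T := (Nat.primeFactors_mono hmM hM0).trans hM
  refine ⟨m, mem_smoothBetween.2 ⟨hm0, hmT, hYm, ?_⟩, hmM⟩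
  by_cases hm1 : m = 1
  · rw [hm1, Nat.cast_one]
    exact one_le_mul_of_one_le_of_one_le hc1 hY
  · obtain ⟨p, hp, hpm⟩ := Nat.exists_prime_and_dvd hm1
    have hpT : p ∈ T := hmT (Nat.mem_primeFactors.2 ⟨hp, hpm, hm0⟩)
    obtain ⟨l, rfl⟩ := hpm
    have hl0 : 0 < l := Nat.pos_of_ne_zero (by rintro rfl; simp at hm0)
    have hlY : (l : ℝ) < Y := by
      by_contra hle
      have := hmin l ⟨⟨(dvd_mul_left _ _).trans hmM, hM0⟩, not_lt.1 hle⟩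
      nlinarith [hp.two_le]
    push_cast
    exact mul_le_mul (hc p hpT) hlY.le (by positivity) (by linarith)

/-- The inner sum is dominated by its top term `j = c + n i`, turning `q ^ i` into `y ^ i`. The ones
contribute `O((k + 2)²)`, absorbed since `y ≥ 2`. In the application `x = 2 ^ (1 - ε)`, `q = 2 ^ (2
- n)` and `y = 2 ^ (2 - n ε)`. -/
theorem sum_geom_two_dim_le {a x y q : ℝ} (ha : 0 ≤ a) (hx : 1 < x) (hy : 2 ≤ y) (hq : 0 ≤ q) {n : ℕ}
    (hxy : x ^ n * q = y) (c : ℕ) : ∃ C : ℝ, 0 < C ∧ ∀ k : ℕ,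
      ∑ i ∈ Finset.range (k + 2), ∑ j ∈ Finset.range (c + n * i + 1), (1 + a * x ^ j * q ^ i) ≤
        C * y ^ k := by
  have hgeom : ∀ {t : ℝ}, 1 < t → ∀ N : ℕ, ∑ j ∈ Finset.range N, t ^ j ≤ t ^ N / (t - 1) :=
    fun {t} ht N ↦ by
      rw [geom_sum_eq ht.ne']
      exact div_le_div_of_nonneg_right (by linarith) (by linarith)
  have hsq : ∀ k : ℕ, ((k : ℝ) + 2) ^ 2 ≤ 8 * 2 ^ k := by
    intro k
    induction k with
    | zero => norm_num
    | succ k ih =>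
      rcases Nat.eq_zero_or_pos k with rfl | hk
      · norm_num
      · have : (1 : ℝ) ≤ k := by exact_mod_cast hk
        rw [pow_succ (2 : ℝ)]
        push_cast
        nlinarith
  have hx1 : 0 < x - 1 := by linarith
  have hy1 : 0 < y - 1 := by linarith
  refine ⟨8 * (c + n + 1) + a * (x ^ (c + 1) / (x - 1)) * (y ^ 2 / (y - 1)), by positivity,
    fun k ↦ ?_⟩
  have hinner : ∀ i ∈ Finset.range (k + 2), ∑ j ∈ Finset.range (c + n * i + 1),
      (1 + a * x ^ j * q ^ i) ≤ (c + n + 1) * ((k : ℝ) + 2) + a * (x ^ (c + 1) / (x - 1)) * y ^ i := by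
    intro i hi
    have hik : (i : ℝ) ≤ k + 1 := by
      have := Finset.mem_range.1 hi
      exact_mod_cast (by omega : i ≤ k + 1)
    rw [Finset.sum_add_distrib, ← Finset.sum_mul, ← Finset.mul_sum]
    apply add_le_add
    · rw [Finset.sum_const, Finset.card_range, nsmul_eq_mul, mul_one]
      push_cast
      nlinarith [Nat.cast_nonneg (α := ℝ) n, Nat.cast_nonneg (α := ℝ) c, Nat.cast_nonneg (α := ℝ) k]
    · calc a * (∑ j ∈ Finset.range (c + n * i + 1), x ^ j) * q ^ i
          ≤ a * (x ^ (c + n * i + 1) / (x - 1)) * q ^ i := by gcongr; exact hgeom hx _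
        _ = a * (x ^ (c + 1) / (x - 1)) * y ^ i := by
          rw [← hxy, mul_pow, ← pow_mul]; ring
  refine (Finset.sum_le_sum hinner).trans ?_
  rw [Finset.sum_add_distrib, Finset.sum_const, Finset.card_range, nsmul_eq_mul, ← Finset.mul_sum]
  have h1 := hgeom (by linarith : 1 < y) (k + 2)
  have h2 : (2 : ℝ) ^ k ≤ y ^ k := pow_le_pow_left₀ (by norm_num) hy k
  have h3 := hsq k
  have h4 : ((k + 2 : ℕ) : ℝ) * ((c + n + 1) * ((k : ℝ) + 2)) ≤ 8 * (c + n + 1) * y ^ k := by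
    push_cast
    have : ((k : ℝ) + 2) ^ 2 ≤ 8 * y ^ k := by linarith
    calc ((k : ℝ) + 2) * ((c + n + 1) * ((k : ℝ) + 2)) = (c + n + 1) * ((k : ℝ) + 2) ^ 2 := by ring
      _ ≤ (c + n + 1) * (8 * y ^ k) := by gcongr
      _ = _ := by ring
  have h5 : a * (x ^ (c + 1) / (x - 1)) * ∑ i ∈ Finset.range (k + 2), y ^ i ≤
      a * (x ^ (c + 1) / (x - 1)) * (y ^ 2 / (y - 1)) * y ^ k := by
    calc _ ≤ a * (x ^ (c + 1) / (x - 1)) * (y ^ (k + 2) / (y - 1)) := by gcongr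
      _ = _ := by ring
  linarith

/-- The points counted by `countLargeSPart`, as a finite set. -/
theorem exists_finset_countLargeSPart (F : MvPolynomial (Fin 2) ℤ) (S : Finset ℕ) (ε B : ℝ) :
    ∃ E : Finset (ℤ × ℤ), E.card = countLargeSPart F S ε B ∧ ∀ z, z ∈ E ↔
      IsCoprime z.1 z.2 ∧ max |(z.1 : ℝ)| |(z.2 : ℝ)| ≤ B ∧ formVal F z.1 z.2 ≠ 0 ∧
        |(formVal F z.1 z.2 : ℝ)| ^ ε ≤ (sPart S (formVal F z.1 z.2) : ℝ) := by
  have hfin : {z : ℤ × ℤ | IsCoprime z.1 z.2 ∧ max |(z.1 : ℝ)| |(z.2 : ℝ)| ≤ B ∧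
      formVal F z.1 z.2 ≠ 0 ∧
      |(formVal F z.1 z.2 : ℝ)| ^ ε ≤ (sPart S (formVal F z.1 z.2) : ℝ)}.Finite := by
    refine ((Set.finite_Icc (-⌊B⌋) ⌊B⌋).prod (Set.finite_Icc (-⌊B⌋) ⌊B⌋)).subset ?_
    rintro z ⟨-, hz, -⟩
    obtain ⟨h1, h2⟩ := max_le_iff.1 hz
    have key : ∀ t : ℤ, |(t : ℝ)| ≤ B → t ∈ Set.Icc (-⌊B⌋) ⌊B⌋ := fun t ht ↦ by
      rw [Set.mem_Icc, ← abs_le, Int.le_floor]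
      exact_mod_cast ht
    exact ⟨key _ h1, key _ h2⟩
  refine ⟨hfin.toFinset, ?_, fun z ↦ by simp⟩
  rw [countLargeSPart, Set.ncard_eq_toFinset_card _ hfin]

theorem countLargeSPart_isBigO (n : ℕ) (hn : 3 ≤ n) (F : MvPolynomial (Fin 2) ℤ)
    (hF : F.IsHomogeneous n) (hD : formDiscr n F ≠ 0) (ε : ℝ) (hε0 : 0 < ε)
    (hε1 : ε < 1 / (n : ℝ)) (S : Finset ℕ) (hS : ∀ p ∈ S, p.Prime)
    (hs : 0 < numSolvablePrimes n F S) :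
    (fun B : ℝ => (countLargeSPart F S ε B : ℝ)) =O[atTop]
      (fun B : ℝ => B ^ (2 - (n : ℝ) * ε) * Real.log B ^ (numSolvablePrimes n F S - 1)) := by
  classical
  set T := solvablePrimes n F S with hT
  have hTp : ∀ p ∈ T, p.Prime := fun p hp ↦ hS p (solvablePrimes_subset n F S hp)
  have hTne : T.Nonempty := Finset.card_pos.1 hs
  rw [← card_solvablePrimes, ← hT]
  have hn0 : (3 : ℝ) ≤ n := by exact_mod_cast hn
  have hnε : n * ε < 1 := by rwa [lt_div_iff₀ (by linarith), mul_comm] at hε1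
  have hεlt : ε < 1 := by nlinarith
  obtain ⟨C₁, hC₁, hFle⟩ := exists_abs_formVal_le (by omega) hF
  obtain ⟨C₂, hC₂, hshell⟩ := exists_card_shell_le hn hF hD T hTp
  set P : ℝ := 1 + ∑ p ∈ T, (p : ℝ) with hP
  have hP1 : 1 ≤ P := by
    have : 0 ≤ ∑ p ∈ T, (p : ℝ) := by positivity
    linarith
  have hPp : ∀ p ∈ T, (p : ℝ) ≤ P := fun p hp ↦ by
    have := Finset.single_le_sum (f := fun p : ℕ ↦ (p : ℝ)) (fun _ _ ↦ by positivity) hp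
    linarith
  obtain ⟨C₃, hC₃, hsmooth⟩ := card_smoothBetween_le hTp hTne hP1
  set C₀ : ℕ := ∏ p ∈ S, p ^ padicValInt p (formDiscr n F) with hC₀
  have hC₀1 : (1 : ℝ) ≤ C₀ := by
    have : C₀ ≠ 0 := Finset.prod_ne_zero_iff.2 fun p hp ↦ pow_ne_zero _ (hS p hp).ne_zero
    exact_mod_cast Nat.one_le_iff_ne_zero.2 this
  obtain ⟨c, hc⟩ := pow_unbounded_of_one_lt C₁ (one_lt_two (α := ℝ))
  set t : ℝ := 2 ^ ε with ht
  have ht0 : 0 < t := by positivity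
  set x : ℝ := 2 / t with hx
  set q : ℝ := 4 / 2 ^ n with hq
  set y : ℝ := 2 ^ (2 - n * ε) with hy
  have hx1 : 1 < x := by
    rw [hx, one_lt_div ht0]
    conv_rhs => rw [← Real.rpow_one 2]
    exact Real.rpow_lt_rpow_of_exponent_lt one_lt_two hεlt
  have hy2 : 2 ≤ y := by
    conv_lhs => rw [← Real.rpow_one 2]
    exact Real.rpow_le_rpow_of_exponent_le one_le_two (by linarith)
  have hxy : x ^ n * q = y := by
    rw [hx, hq, hy, Real.rpow_sub two_pos, mul_comm (n : ℝ) ε, Real.rpow_mul_natCast (by norm_num),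
      ← ht, div_pow]
    norm_num
  obtain ⟨C₄, hC₄, hsum⟩ := sum_geom_two_dim_le (a := 2 * C₀) (by positivity) hx1 hy2
    (by positivity) hxy c
  refine IsBigO.of_bound (C₂ * C₃ * (1 + c + 3 * n) ^ (T.card - 1) * C₄) ?_
  filter_upwards [eventually_ge_atTop (3 : ℝ)] with B hB
  have hlogB : 1 ≤ Real.log B := by
    rw [Real.le_log_iff_exp_le (by linarith)]
    linarith [Real.exp_one_lt_d9]
  rw [Real.norm_of_nonneg (by positivity), Real.norm_of_nonneg (by positivity)]
  obtain ⟨E, hE, hEmem⟩ := exists_finset_countLargeSPart F S ε B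
  rw [← hE]
  obtain ⟨k, hk1, hk2⟩ := exists_nat_pow_near (by linarith : 1 ≤ B) (one_lt_two (α := ℝ))
  -- A value of size at least `2 ^ j` needs `S`-part at least `t ^ j`; `C₀` bounds the share lost to
  -- unsolvable primes.
  let Y : ℕ → ℝ := fun j ↦ max 1 (t ^ j / C₀)
  have hY1 : ∀ j, 1 ≤ Y j := fun j ↦ le_max_left _ _
  let A : ℕ → ℕ → ℕ → Finset (ℤ × ℤ) := fun i j M ↦ E.filter fun z ↦
    (2 : ℝ) ^ i / 2 ≤ max |(z.1 : ℝ)| |(z.2 : ℝ)| ∧ max |(z.1 : ℝ)| |(z.2 : ℝ)| ≤ 2 ^ i ∧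
    |(formVal F z.1 z.2 : ℝ)| ≤ 2 ^ (j + 1) ∧ (M : ℤ) ∣ formVal F z.1 z.2
  have hcover : E ⊆ (Finset.range (k + 2)).biUnion fun i ↦ (Finset.range (c + n * i + 1)).biUnion
      fun j ↦ (smoothBetween T (Y j) P).biUnion fun M ↦ A i j M := by
    intro z hz
    obtain ⟨hz1, hz2, hz3, hz4⟩ := (hEmem z).1 hz
    have hr : 1 ≤ max |(z.1 : ℝ)| |(z.2 : ℝ)| := by
      by_contra hlt
      push Not at hlt
      obtain ⟨h1, h2⟩ := max_lt_iff.1 hlt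
      have h1' : |z.1| < 1 := by exact_mod_cast h1
      have h2' : |z.2| < 1 := by exact_mod_cast h2
      rw [Int.abs_lt_one_iff] at h1' h2'
      rw [h1', h2'] at hz1
      exact absurd hz1 (by norm_num)
    have hv : (1 : ℝ) ≤ |(formVal F z.1 z.2 : ℝ)| := by exact_mod_cast Int.one_le_abs hz3
    obtain ⟨i, hi1, hi2⟩ := exists_nat_pow_near hr (one_lt_two (α := ℝ))
    obtain ⟨j, hj1, hj2⟩ := exists_nat_pow_near hv (one_lt_two (α := ℝ))
    have hik : i < k + 1 := by
      rw [← pow_lt_pow_iff_right₀ (one_lt_two (α := ℝ))]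
      linarith
    -- At height at most `2 ^ (i + 1)` the form is at most `C₁ * 2 ^ (n (i + 1))`, and `C₁ < 2 ^ c`.
    -- Shells are indexed by their upper end `i + 1`.
    have hjc : j ≤ c + n * (i + 1) := by
      rw [← pow_le_pow_iff_right₀ (one_lt_two (α := ℝ))]
      obtain ⟨h1, h2⟩ := max_le_iff.1 hi2.le
      have h3 := hFle z.1 z.2 _ h1 h2
      rw [pow_add, mul_comm n, pow_mul]
      refine hj1.trans (h3.trans ?_)
      gcongr
    set M := ∏ p ∈ T, p ^ padicValInt p (formVal F z.1 z.2) with hM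
    have hM0 : M ≠ 0 := Finset.prod_ne_zero_iff.2 fun p hp ↦ pow_ne_zero _ (hTp p hp).ne_zero
    have hYM : Y j ≤ M := by
      apply max_le
      · exact_mod_cast Nat.one_le_iff_ne_zero.2 hM0
      · rw [div_le_iff₀ (by linarith)]
        have h1 : (sPart S (formVal F z.1 z.2) : ℝ) ≤ C₀ * M := by
          exact_mod_cast sPart_le_mul_prod (n := n) hS hz1
        have h2 : t ^ j ≤ |(formVal F z.1 z.2 : ℝ)| ^ ε := by
          rw [ht, ← Real.rpow_mul_natCast (by norm_num), mul_comm, Real.rpow_natCast_mul (by norm_num)]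
          exact Real.rpow_le_rpow (by positivity) hj1 hε0.le
        linarith
    obtain ⟨m, hm, hmM⟩ := exists_dvd_mem_smoothBetween hP1 hPp (hY1 j) hM0
      (primeFactors_prod_pow_subset hTp _) hYM
    simp only [Finset.mem_biUnion, Finset.mem_range]
    refine ⟨i + 1, by omega, j, by omega, m, hm, Finset.mem_filter.2 ⟨hz, ?_, hi2.le, hj2.le, ?_⟩⟩
    · rw [pow_succ]; linarith
    · exact (Int.natCast_dvd_natCast.2 hmM).trans (prod_pow_padicValInt_dvd hTp _)
  have hcardA : ∀ i j, ∀ M ∈ smoothBetween T (Y j) P, ((A i j M).card : ℝ) ≤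
      C₂ * (1 + 2 * C₀ * x ^ j * q ^ i) := by
    intro i j M hM
    obtain ⟨h1, h2, h3, -⟩ := mem_smoothBetween.1 hM
    refine (hshell (2 ^ i) (2 ^ (j + 1)) M (A i j M) (by positivity) (by positivity) h1 h2
      fun z hz ↦ ?_).trans ?_
    · obtain ⟨hz1, hz2⟩ := Finset.mem_filter.1 hz
      exact ⟨((hEmem z).1 hz1).1, hz2⟩
    · gcongr
      have h4 : t ^ j / C₀ ≤ M := (le_max_right _ _).trans h3
      have h5 : 0 < t ^ j / C₀ := by positivity
      calc (2 : ℝ) ^ (j + 1) * (2 ^ i) ^ 2 / (2 ^ i) ^ n / M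
          ≤ (2 : ℝ) ^ (j + 1) * (2 ^ i) ^ 2 / (2 ^ i) ^ n / (t ^ j / C₀) := by gcongr
        _ = 2 * C₀ * x ^ j * q ^ i := by
          have e1 : ((2 : ℝ) ^ i) ^ 2 = 4 ^ i := by rw [← pow_mul, mul_comm, pow_mul]; norm_num
          have e2 : ((2 : ℝ) ^ i) ^ n = (2 ^ n) ^ i := by rw [← pow_mul, mul_comm, pow_mul]
          rw [hx, hq, div_pow, div_pow, e1, e2, pow_succ]
          field_simp
  set L : ℝ := (1 + c + 3 * n) * Real.log B with hL
  have hcardY : ∀ i ∈ Finset.range (k + 2), ∀ j ∈ Finset.range (c + n * i + 1),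
      ((smoothBetween T (Y j) P).card : ℝ) ≤ C₃ * L ^ (T.card - 1) := by
    intro i hi j hj
    refine (hsmooth _ (hY1 j)).trans ?_
    have h0 := Real.log_nonneg (hY1 j)
    have hlog2 : Real.log 2 ≤ 1 := by linarith [Real.log_two_lt_d9]
    have hlog2' : 1 / 2 ≤ Real.log 2 := by linarith [Real.log_two_gt_d9]
    have h1 : Real.log (Y j) ≤ j := by
      have h2 : Y j ≤ 2 ^ j := by
        apply max_le (one_le_pow₀ one_le_two)
        refine (div_le_self (by positivity) hC₀1).trans ?_
        apply pow_le_pow_left₀ ht0.le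
        rw [hx, one_lt_div ht0] at hx1
        exact hx1.le
      have h3 := Real.log_le_log (by linarith [hY1 j]) h2
      rw [Real.log_pow] at h3
      have : (j : ℝ) * Real.log 2 ≤ j * 1 := by gcongr
      linarith
    have h2 : (k : ℝ) ≤ 2 * Real.log B := by
      have h3 := Real.log_le_log (by positivity) hk1
      rw [Real.log_pow] at h3
      nlinarith [Nat.cast_nonneg (α := ℝ) k]
    have h3 : (j : ℝ) ≤ c + n * (k + 1) := by
      rw [Finset.mem_range] at hi hj
      have : n * i ≤ n * (k + 1) := Nat.mul_le_mul_left n (by omega)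
      exact_mod_cast (by omega : j ≤ c + n * (k + 1))
    have h4 : 1 + Real.log (Y j) ≤ L := by
      have h5 : (c : ℝ) ≤ c * Real.log B := le_mul_of_one_le_right (by positivity) hlogB
      have h6 : (n : ℝ) * k ≤ n * (2 * Real.log B) := by gcongr
      have h7 : (n : ℝ) ≤ n * Real.log B := le_mul_of_one_le_right (by positivity) hlogB
      rw [hL]
      linarith
    gcongr
  have hLpow : L ^ (T.card - 1) = (1 + c + 3 * n) ^ (T.card - 1) * Real.log B ^ (T.card - 1) := by
    rw [hL, mul_pow]
  have hcard : (E.card : ℝ) ≤ ∑ i ∈ Finset.range (k + 2), ∑ j ∈ Finset.range (c + n * i + 1),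
      ∑ M ∈ smoothBetween T (Y j) P, ((A i j M).card : ℝ) := by
    have := (Finset.card_le_card hcover).trans (Finset.card_biUnion_le.trans
      (Finset.sum_le_sum fun i _ ↦ Finset.card_biUnion_le.trans
        (Finset.sum_le_sum fun j _ ↦ Finset.card_biUnion_le)))
    exact_mod_cast this
  have hyB : y ^ k ≤ B ^ (2 - n * ε) := by
    rw [hy, ← Real.rpow_mul_natCast (by norm_num), mul_comm, Real.rpow_natCast_mul (by norm_num)]
    exact Real.rpow_le_rpow (by positivity) hk1 (by linarith)
  have hL0 : 0 ≤ L := by positivity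
  calc (E.card : ℝ) ≤ ∑ i ∈ Finset.range (k + 2), ∑ j ∈ Finset.range (c + n * i + 1),
        (C₃ * L ^ (T.card - 1) * C₂) * (1 + 2 * C₀ * x ^ j * q ^ i) := by
        refine hcard.trans (Finset.sum_le_sum fun i hi ↦ Finset.sum_le_sum fun j hj ↦ ?_)
        refine (Finset.sum_le_sum (hcardA i j)).trans ?_
        rw [Finset.sum_const, nsmul_eq_mul, mul_assoc (C₃ * L ^ (T.card - 1))]
        refine mul_le_mul_of_nonneg_right (hcardY i hi j hj) (by positivity)
    _ = (C₃ * L ^ (T.card - 1) * C₂) * ∑ i ∈ Finset.range (k + 2),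
        ∑ j ∈ Finset.range (c + n * i + 1), (1 + 2 * C₀ * x ^ j * q ^ i) := by
        simp only [Finset.mul_sum]
    _ ≤ (C₃ * L ^ (T.card - 1) * C₂) * (C₄ * B ^ (2 - n * ε)) := by
        refine mul_le_mul_of_nonneg_left ((hsum k).trans ?_) (by positivity)
        gcongr
    _ = _ := by rw [hLpow]; ring

/-! ### The lower bound -/

theorem exists_int_crt {T : Finset ℕ} (hT : ∀ p ∈ T, p.Prime) (e : ℕ → ℕ) (a : ℕ → ℤ) :
    ∃ R : ℤ, ∀ p ∈ T, (p : ℤ) ^ e p ∣ R - a p := by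
  classical
  induction T using Finset.induction_on with
  | empty => exact ⟨0, by simp⟩
  | insert p T hp ih =>
    obtain ⟨R, hR⟩ := ih fun q hq ↦ hT q (Finset.mem_insert_of_mem hq)
    have hcop : IsCoprime ((p : ℤ) ^ e p) (∏ q ∈ T, (q : ℤ) ^ e q) := by
      refine IsCoprime.prod_right fun q hq ↦ IsCoprime.pow ?_
      refine Nat.isCoprime_iff_coprime.2 ((Nat.coprime_primes (hT p (Finset.mem_insert_self _ _))
        (hT q (Finset.mem_insert_of_mem hq))).2 ?_)
      rintro rfl
      exact hp hq
    obtain ⟨u, v, huv⟩ := hcop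
    refine ⟨R + (∏ q ∈ T, (q : ℤ) ^ e q) * (v * (a p - R)), fun q hq ↦ ?_⟩
    rcases Finset.mem_insert.1 hq with rfl | hq
    · exact ⟨u * (R - a q), by linear_combination (R - a q) * (-huv)⟩
    · rw [add_sub_right_comm]
      exact dvd_add (hR q hq) ((Finset.dvd_prod_of_mem _ hq).mul_right _)

theorem Int.natCast_dvd_of_forall_factorization {M : ℕ} (hM : M ≠ 0) {m : ℤ}
    (h : ∀ p ∈ M.primeFactors, (p : ℤ) ^ M.factorization p ∣ m) : (M : ℤ) ∣ m := by
  rw [Int.natCast_dvd, Nat.dvd_iff_prime_pow_dvd_dvd]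
  intro p k hp hk
  rcases Nat.eq_zero_or_pos k with rfl | hk0
  · simp
  have h1 := h p (Nat.mem_primeFactors.2 ⟨hp, (dvd_pow_self p hk0.ne').trans hk, hM⟩)
  have h2 : k ≤ M.factorization p := (hp.pow_dvd_iff_le_factorization hM).1 hk
  rw [← Int.natCast_dvd]
  push_cast
  exact (pow_dvd_pow _ h2).trans h1

theorem le_sPart_of_dvd {S : Finset ℕ} (hS : ∀ p ∈ S, p.Prime) {M : ℕ} (hM : M ≠ 0)
    (hMS : M.primeFactors ⊆ S) {m : ℤ} (hm : m ≠ 0) (h : (M : ℤ) ∣ m) : M ≤ sPart S m := by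
  conv_lhs => rw [← Nat.prod_factorization_pow_eq_self hM]
  rw [Finsupp.prod_of_support_subset _ (by simpa using hMS) _ (by simp), sPart]
  refine Finset.prod_le_prod' fun p hp ↦ Nat.pow_le_pow_right (hS p hp).pos ?_
  have : Fact p.Prime := ⟨hS p hp⟩
  have h1 : (p : ℤ) ^ M.factorization p ∣ m := by
    refine Dvd.dvd.trans ?_ h
    exact_mod_cast Nat.ordProj_dvd M p
  rw [padicValInt_dvd_iff] at h1
  exact h1.resolve_left hm

/-- A point near the `p`-adic zero approximated by `ρ` makes the form divisible by a power of `p`. -/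
theorem pow_dvd_formVal_of_approx {n : ℕ} {F : MvPolynomial (Fin 2) ℤ} (hF : F.IsHomogeneous n)
    {d c ρ x y : ℤ} (hρ : d ∣ formVal F ρ (1 - c * ρ)) (hx : d ∣ x - ρ * y) :
    d ∣ formVal F x (y - c * x) := by
  have h1 := dvd_aeval_sub_aeval F hx (t := y - c * x) (t' := y - c * (ρ * y))
    (by convert hx.mul_left (-c) using 1; ring)
  have h2 : MvPolynomial.aeval ![ρ * y, y - c * (ρ * y)] F = y ^ n * formVal F ρ (1 - c * ρ) := by
    rw [← aeval_int_eq_formVal, ← aeval_smul_of_isHomogeneous hF]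
    congr 3
    · ring
    · congr 1; ring
  rw [h2, aeval_int_eq_formVal] at h1
  exact (dvd_sub_left (hρ.mul_left _)).1 h1

theorem eventually_le_rpow {a δ : ℝ} (ha : 0 < a) (hδ : 0 < δ) :
    ∀ᶠ B : ℝ in atTop, 8 * B * (1 + Real.log B) ≤ a * B ^ (1 + δ) := by
  have h1 : (fun B : ℝ ↦ 1 + Real.log B) =o[atTop] fun B ↦ B ^ δ := by
    refine IsLittleO.add ?_ (isLittleO_log_rpow_atTop hδ)
    rw [isLittleO_const_left]
    exact Or.inr (tendsto_norm_atTop_atTop.comp (tendsto_rpow_atTop hδ))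
  filter_upwards [h1.def (by positivity : 0 < a / 8), eventually_ge_atTop 1] with B hB hB1
  rw [Real.norm_of_nonneg (by have := Real.log_nonneg hB1; positivity),
    Real.norm_of_nonneg (by positivity)] at hB
  rw [Real.rpow_add (by linarith), Real.rpow_one]
  calc 8 * B * (1 + Real.log B) ≤ 8 * B * (a / 8 * B ^ δ) := by gcongr
    _ = _ := by ring

theorem isBigO_countLargeSPart (n : ℕ) (hn : 3 ≤ n) (F : MvPolynomial (Fin 2) ℤ)
    (hF : F.IsHomogeneous n) (hD : formDiscr n F ≠ 0) (ε : ℝ) (hε0 : 0 < ε)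
    (hε1 : ε < 1 / (n : ℝ)) (S : Finset ℕ) (hS : ∀ p ∈ S, p.Prime)
    (hs : 0 < numSolvablePrimes n F S) :
    (fun B : ℝ => B ^ (2 - (n : ℝ) * ε) * Real.log B ^ (numSolvablePrimes n F S - 1)) =O[atTop]
      (fun B : ℝ => (countLargeSPart F S ε B : ℝ)) := by
  classical
  set T := solvablePrimes n F S with hT
  have hTS : T ⊆ S := solvablePrimes_subset n F S
  have hTp : ∀ p ∈ T, p.Prime := fun p hp ↦ hS p (hTS hp)
  have hTne : T.Nonempty := Finset.card_pos.1 hs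
  rw [← card_solvablePrimes, ← hT]
  have hn0 : (3 : ℝ) ≤ n := by exact_mod_cast hn
  have hnε : n * ε < 1 := by rwa [lt_div_iff₀ (by linarith), mul_comm] at hε1
  obtain ⟨C₁, hC₁, hFle⟩ := exists_abs_formVal_le (by omega) hF
  set P : ℝ := 1 + ∑ p ∈ T, (p : ℝ) with hP
  have hP1 : 1 ≤ P := by
    have : 0 ≤ ∑ p ∈ T, (p : ℝ) := by positivity
    linarith
  have hPp : ∀ p ∈ T, (p : ℝ) ≤ P := fun p hp ↦ by
    have := Finset.single_le_sum (f := fun p : ℕ ↦ (p : ℝ)) (fun _ _ ↦ by positivity) hp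
    linarith
  obtain ⟨C₃, hC₃, hsmooth⟩ := le_card_smoothBetween hTp hTne hPp
  set Q : ℕ := ∏ p ∈ T, p with hQ
  have hQ1 : 1 ≤ Q := Nat.one_le_iff_ne_zero.2 (Finset.prod_ne_zero_iff.2 fun p hp ↦
    (hTp p hp).ne_zero)
  have hpQ : ∀ p ∈ T, p ∣ Q := fun p hp ↦ Finset.dvd_prod_of_mem _ hp
  have hroots : ∀ p ∈ T, ∃ c₀ : ℕ, ∀ c : ℤ, (p : ℤ) ∣ c - c₀ → ∃ ρ : ℕ → ℤ,
      (∀ k m, k ≤ m → (p : ℤ) ^ k ∣ ρ m - ρ k) ∧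
      ∀ k, (p : ℤ) ^ k ∣ formVal F (ρ k) (1 - c * ρ k) := by
    intro p hp
    have : Fact p.Prime := ⟨hTp p hp⟩
    refine exists_approximate_zeros hn hF (hTp p hp) (g := padicValInt p (formDiscr n F)) ?_
      (Finset.mem_filter.1 hp).2
    rw [padicValInt_dvd_iff]
    simp [hD]
  choose! c₀ hc₀ using hroots
  -- One integral shear that makes the chosen `p`-adic zeros finite for all `p ∈ T` at once.
  obtain ⟨c, hc⟩ := exists_int_crt hTp (fun _ ↦ 1) fun p ↦ (c₀ p : ℤ)
  simp only [pow_one] at hc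
  have hroots : ∀ p ∈ T, ∃ ρ : ℕ → ℤ, (∀ k m, k ≤ m → (p : ℤ) ^ k ∣ ρ m - ρ k) ∧
      ∀ k, (p : ℤ) ^ k ∣ formVal F (ρ k) (1 - c * ρ k) := fun p hp ↦ hc₀ p hp c (hc p hp)
  choose! ρ hρ using hroots
  -- The line passes through the `p`-adic zero displaced by `M`. Its points then approach the zero
  -- modulo `p ^ v_p(M)` but not modulo the next power.
  have hcrt : ∀ M : ℕ, ∃ R : ℤ, ∀ p ∈ T, (p : ℤ) ^ (M.factorization p + 1) ∣
      R - (ρ p (M.factorization p + 1) + M) := fun M ↦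
    exists_int_crt hTp (fun p ↦ M.factorization p + 1)
      fun p ↦ ρ p (M.factorization p + 1) + M
  choose R hR using hcrt
  let A : ℕ → ℕ → Finset (ℤ × ℤ) := fun b M ↦
    (Finset.Icc (-(b : ℤ)) b ×ˢ Finset.Icc (1 : ℤ) b).filter fun z ↦ (Q : ℤ) ∣ z.2 - 1 ∧
      ((M * Q : ℕ) : ℤ) ∣ z.1 - R M * z.2 ∧ IsCoprime z.1 z.2
  have hAmem : ∀ b M z, z ∈ A b M ↔ (|z.1| ≤ b ∧ 1 ≤ z.2 ∧ z.2 ≤ b) ∧ (Q : ℤ) ∣ z.2 - 1 ∧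
      ((M * Q : ℕ) : ℤ) ∣ z.1 - R M * z.2 ∧ IsCoprime z.1 z.2 := fun b M z ↦ by
    simp only [A, Finset.mem_filter, Finset.mem_product, Finset.mem_Icc, abs_le]
  have hnear : ∀ b M z, M ≠ 0 → z ∈ A b M → ∀ p ∈ T, ¬ (p : ℤ) ∣ z.2 ∧
      (p : ℤ) ^ (M.factorization p + 1) ∣
        z.1 - ρ p (M.factorization p + 1) * z.2 - M * z.2 := by
    intro b M z hM hz p hp
    obtain ⟨-, h1, h2, -⟩ := (hAmem b M z).1 hz
    have hpQ' : (p : ℤ) ∣ Q := Int.natCast_dvd_natCast.2 (hpQ p hp)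
    refine ⟨fun h ↦ (Nat.prime_iff_prime_int.1 (hTp p hp)).not_dvd_one ?_, ?_⟩
    · have := dvd_sub h (hpQ'.trans h1)
      rwa [sub_sub_cancel] at this
    · have h3 : (p : ℤ) ^ (M.factorization p + 1) ∣ ((M * Q : ℕ) : ℤ) := by
        rw [pow_succ]
        push_cast
        exact mul_dvd_mul (by exact_mod_cast Nat.ordProj_dvd M p) hpQ'
      have := dvd_add (h3.trans h2) ((hR M p hp).mul_right z.2)
      exact this.trans (dvd_of_eq (by ring))
  -- The exact order of approach at each `p ∈ T` recovers `v_p(M)`, since `z.2` is prime to `p`.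
  have hdisj : ∀ b M M', M ≠ 0 → M' ≠ 0 → M.primeFactors ⊆ T → M'.primeFactors ⊆ T → ∀ z,
      z ∈ A b M → z ∈ A b M' → M = M' := by
    intro b M M' hM hM' hMT hMT' z hz hz'
    have key : ∀ M M' : ℕ, M ≠ 0 → M' ≠ 0 → z ∈ A b M → z ∈ A b M' → ∀ p ∈ T,
        M'.factorization p ≤ M.factorization p := by
      intro M M' hM hM' hz hz' p hp
      by_contra hlt
      push Not at hlt
      obtain ⟨hpy, h1⟩ := hnear b M z hM hz p hp
      obtain ⟨-, h2⟩ := hnear b M' z hM' hz' p hp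
      have h3 : (p : ℤ) ^ (M.factorization p + 1) ∣ M' :=
        (pow_dvd_pow _ hlt).trans (by exact_mod_cast Nat.ordProj_dvd M' p)
      have h4 := (hρ p hp).1 (M.factorization p + 1) (M'.factorization p + 1) (by omega)
      have h5 : (p : ℤ) ^ (M.factorization p + 1) ∣ M * z.2 := by
        have := dvd_sub ((pow_dvd_pow _ (by omega :
          M.factorization p + 1 ≤ M'.factorization p + 1)).trans h2) h1
        have := dvd_add (dvd_add this (h4.mul_right z.2)) (h3.mul_right z.2)
        exact this.trans (dvd_of_eq (by ring))
      have h6 : (p : ℤ) ^ (M.factorization p + 1) ∣ M := IsCoprime.dvd_of_dvd_mul_right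
        (((Prime.coprime_iff_not_dvd (Nat.prime_iff_prime_int.1 (hTp p hp))).2 hpy).pow_left) h5
      exact Nat.pow_succ_factorization_not_dvd hM (hTp p hp) (by exact_mod_cast h6)
    refine Nat.eq_of_factorization_eq hM hM' fun p ↦ ?_
    by_cases hp : p ∈ T
    · exact le_antisymm (key M' M hM' hM hz' hz p hp) (key M M' hM hM' hz hz' p hp)
    · rw [Finsupp.notMem_support_iff.1 (fun h ↦ hp (hMT (by simpa using h))),
        Finsupp.notMem_support_iff.1 (fun h ↦ hp (hMT' (by simpa using h)))]
  have hdvd : ∀ b M z, M ≠ 0 → M.primeFactors ⊆ T → z ∈ A b M →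
      (M : ℤ) ∣ formVal F z.1 (z.2 - c * z.1) := by
    intro b M z hM hMT hz
    refine Int.natCast_dvd_of_forall_factorization hM fun p hp ↦ ?_
    obtain ⟨-, h1⟩ := hnear b M z hM hz p (hMT hp)
    refine pow_dvd_formVal_of_approx hF ((hρ p (hMT hp)).2 (M.factorization p)) ?_
    have h2 := (hρ p (hMT hp)).1 (M.factorization p) (M.factorization p + 1) (by omega)
    have h3 : (p : ℤ) ^ M.factorization p ∣ M := by exact_mod_cast Nat.ordProj_dvd M p
    have := dvd_add (dvd_add ((pow_dvd_pow _ (by omega)).trans h1) (h2.mul_right z.2))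
      (h3.mul_right z.2)
    exact this.trans (dvd_of_eq (by ring))
  have hcardA : ∀ b M : ℕ, 1 ≤ b → M ≠ 0 → M.primeFactors ⊆ T →
      (b : ℝ) ^ 2 / (2 * (Q * (M * Q : ℕ))) - 8 * b * (1 + Real.log b) ≤ (A b M).card := by
    intro b M hb hM hMT
    refine le_card_coprime hQ1 (Nat.one_le_iff_ne_zero.2 (mul_ne_zero hM (by omega)))
      (fun g hg ↦ Nat.Coprime.mul_right ?_ hg) (R M) hb _ fun x y h1 h2 h3 h4 h5 h6 ↦
        (hAmem b M (x, y)).2 ⟨⟨h3, h1, h2⟩, h4, h5, h6⟩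
    refine Nat.coprime_of_dvd fun r hr hrg hrM ↦ ?_
    have := Nat.dvd_gcd hrg (hpQ r (hMT (Nat.mem_primeFactors.2 ⟨hr, hrM, hM⟩)))
    rw [hg] at this
    exact hr.one_lt.ne' (Nat.dvd_one.1 this)
  -- Undoes the shear; it preserves primitivity and enlarges the height by at most the factor `κ`
  -- below.
  let ψ : ℤ × ℤ → ℤ × ℤ := fun z ↦ (z.1, z.2 - c * z.1)
  have hψ : Function.Injective ψ := by
    rintro ⟨x, y⟩ ⟨x', y'⟩ h
    simp only [ψ, Prod.mk.injEq] at h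
    obtain ⟨rfl, h⟩ := h
    ext
    · rfl
    · simpa using h
  set κ : ℝ := 1 + |(c : ℝ)| with hκ
  have hκ1 : 1 ≤ κ := by linarith [abs_nonneg (c : ℝ)]
  set a : ℝ := 1 / (8 * κ ^ 2 * Q ^ 2 * P * C₁ ^ ε) with ha
  have hQ0 : (0 : ℝ) < Q := by exact_mod_cast hQ1
  have ha0 : 0 < a := by positivity
  set W : ℝ := C₃ * (n * ε) ^ (T.card - 1) * (a / 2) with hW
  have hW0 : 0 < W := by positivity
  refine IsBigO.of_bound (2 / W) ?_
  have hlarge : ∀ᶠ B : ℝ in atTop, 2 * (2 * n) / W ≤ B ^ (2 - n * ε) :=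
    (tendsto_rpow_atTop (by linarith)).eventually_ge_atTop _
  -- Since `2 - n ε > 1`, the error `B log B` of the primitive point count is below half of the main
  -- term.
  have hevent := eventually_le_rpow (half_pos ha0) (by linarith : 0 < 1 - n * ε)
  filter_upwards [eventually_ge_atTop (3 : ℝ), eventually_ge_atTop (2 * κ), hlarge, hevent]
    with B hB hBκ hBW hBlog
  have hlogB : 1 ≤ Real.log B := by
    rw [Real.le_log_iff_exp_le (by linarith)]
    linarith [Real.exp_one_lt_d9]
  rw [Real.norm_of_nonneg (by positivity), Real.norm_of_nonneg (by positivity)]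
  obtain ⟨E, hE, hEmem⟩ := exists_finset_countLargeSPart F S ε B
  rw [← hE]
  set b : ℕ := ⌊B / κ⌋₊ with hb
  have hbκ : (b : ℝ) * κ ≤ B := by
    rw [← le_div_iff₀ (by linarith)]
    exact Nat.floor_le (by positivity)
  have hbB : (b : ℝ) ≤ B := (le_mul_of_one_le_right (by positivity) hκ1).trans hbκ
  have hBb : B / (2 * κ) ≤ b := by
    have h1 := Nat.lt_floor_add_one (B / κ)
    have h2 : 1 ≤ B / (2 * κ) := by rwa [le_div_iff₀ (by positivity), one_mul]
    have h3 : B / κ = B / (2 * κ) + B / (2 * κ) := by field_simp; norm_num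
    rw [← hb] at h1
    linarith
  have hb1 : 1 ≤ b := by
    have h2 : 1 ≤ B / (2 * κ) := by rwa [le_div_iff₀ (by positivity), one_mul]
    exact_mod_cast h2.trans hBb
  have hb1' : (1 : ℝ) ≤ b := by exact_mod_cast hb1
  -- The largest possible `|F| ^ ε` at height `B`, so divisibility by any `M ≥ Y` composed of primes
  -- of `T` secures the `S`-part condition.
  set Y : ℝ := (C₁ * B ^ n) ^ ε with hY
  have hY1 : 1 ≤ Y := Real.one_le_rpow
    (one_le_mul_of_one_le_of_one_le hC₁ (one_le_pow₀ (by linarith))) hε0.le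
  have hYeq : Y = C₁ ^ ε * B ^ (n * ε) := by
    rw [hY, Real.mul_rpow (by linarith) (by positivity), Real.rpow_natCast_mul (by linarith)]
  have hlogY : n * ε * Real.log B ≤ Real.log Y := by
    rw [hYeq, Real.log_mul (by positivity) (by positivity), Real.log_rpow (by linarith),
      Real.log_rpow (by linarith)]
    have := mul_nonneg hε0.le (Real.log_nonneg hC₁)
    linarith
  have hA : ∀ M ∈ smoothBetween T Y P, a / 2 * B ^ (2 - n * ε) ≤ ((A b M).card : ℝ) := by
    intro M hM
    obtain ⟨h1, h2, h3, h4⟩ := mem_smoothBetween.1 hM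
    have hM0 : (0 : ℝ) < M := by positivity
    refine le_trans ?_ (hcardA b M hb1 h1 h2)
    have h5 : a * B ^ (2 - n * ε) ≤ (b : ℝ) ^ 2 / (2 * (Q * (M * Q : ℕ))) := by
      calc a * B ^ (2 - n * ε) = (B / (2 * κ)) ^ 2 / (2 * (Q * (P * Y * Q))) := by
            rw [ha, hYeq, Real.rpow_sub (by linarith)]
            norm_num
            field_simp
            norm_num
        _ ≤ (b : ℝ) ^ 2 / (2 * (Q * (M * Q : ℕ))) := by
            push_cast
            gcongr
    have h6 : 8 * (b : ℝ) * (1 + Real.log b) ≤ a / 2 * B ^ (2 - n * ε) := by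
      have h7 : (2 - n * ε : ℝ) = 1 + (1 - n * ε) := by ring
      rw [h7]
      refine le_trans ?_ hBlog
      have := Real.log_nonneg hb1'
      gcongr
    linarith
  set U := (smoothBetween T Y P).biUnion (A b) with hU
  have hUcard : U.card = ∑ M ∈ smoothBetween T Y P, (A b M).card := by
    refine Finset.card_biUnion fun M hM M' hM' hne ↦ Finset.disjoint_left.2 fun z hz hz' ↦ hne ?_
    obtain ⟨h1, h2, -⟩ := mem_smoothBetween.1 hM
    obtain ⟨h1', h2', -⟩ := mem_smoothBetween.1 hM'
    exact hdisj b M M' h1 h1' h2 h2' z hz hz'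
  have hψcop : ∀ z : ℤ × ℤ, IsCoprime z.1 z.2 → IsCoprime (ψ z).1 (ψ z).2 := by
    rintro ⟨x, y⟩ ⟨u, v, huv⟩
    exact ⟨u + v * c, v, by simp only [ψ]; linear_combination huv⟩
  -- The constructed points may include zeros of the form, of which at most `2 n` are primitive.
  have hUE : (U.image ψ).card ≤ E.card + 2 * n := by
    have hsplit : U.image ψ ⊆ E ∪ (U.image ψ).filter fun z ↦ formVal F z.1 z.2 = 0 := by
      intro w hw
      rw [Finset.mem_union]
      by_cases h0 : formVal F w.1 w.2 = 0
      · exact Or.inr (Finset.mem_filter.2 ⟨hw, h0⟩)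
      left
      obtain ⟨z, hz, rfl⟩ := Finset.mem_image.1 hw
      obtain ⟨M, hM, hzM⟩ := Finset.mem_biUnion.1 hz
      obtain ⟨h1, h2, h3, h4⟩ := mem_smoothBetween.1 hM
      obtain ⟨⟨hz1, hz2, hz3⟩, -, -, hz4⟩ := (hAmem b M z).1 hzM
      have hz1' : |(z.1 : ℝ)| ≤ b := by exact_mod_cast hz1
      have hz2' : |(z.2 : ℝ)| ≤ b := by
        rw [abs_of_nonneg (by exact_mod_cast (by omega : 0 ≤ z.2))]
        exact_mod_cast hz3
      have hw1 : |((ψ z).1 : ℝ)| ≤ B := hz1'.trans hbB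
      have hw2 : |((ψ z).2 : ℝ)| ≤ B := by
        simp only [ψ]
        push_cast
        refine (abs_sub _ _).trans (le_trans ?_ hbκ)
        rw [abs_mul, hκ]
        have := mul_le_mul_of_nonneg_left hz1' (abs_nonneg (c : ℝ))
        linarith
      refine (hEmem _).2 ⟨hψcop z hz4, max_le hw1 hw2, h0, ?_⟩
      have hM' : (M : ℝ) ≤ sPart S (formVal F (ψ z).1 (ψ z).2) := by
        exact_mod_cast le_sPart_of_dvd hS h1 (h2.trans hTS) h0 (hdvd b M z h1 h2 hzM)
      exact (Real.rpow_le_rpow (abs_nonneg _) (hFle _ _ B hw1 hw2) hε0.le).trans (h3.trans hM')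
    refine (Finset.card_le_card hsplit).trans ((Finset.card_union_le _ _).trans
      (Nat.add_le_add_left ?_ _))
    refine card_primitive_zeros_le (by omega) hF hD _ fun w hw ↦ ?_
    obtain ⟨hw, h0⟩ := Finset.mem_filter.1 hw
    obtain ⟨z, hz, rfl⟩ := Finset.mem_image.1 hw
    obtain ⟨M, -, hzM⟩ := Finset.mem_biUnion.1 hz
    exact ⟨hψcop z ((hAmem b M z).1 hzM).2.2.2, h0⟩
  rw [Finset.card_image_of_injective _ hψ, hUcard] at hUE
  have hUE' : ∑ M ∈ smoothBetween T Y P, ((A b M).card : ℝ) ≤ E.card + 2 * n := by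
    exact_mod_cast hUE
  have hmain : W * (B ^ (2 - n * ε) * Real.log B ^ (T.card - 1)) ≤ E.card + 2 * n := by
    calc W * (B ^ (2 - n * ε) * Real.log B ^ (T.card - 1))
        = C₃ * (n * ε * Real.log B) ^ (T.card - 1) * (a / 2 * B ^ (2 - n * ε)) := by
          rw [hW, mul_pow]; ring
      _ ≤ C₃ * (1 + Real.log Y) ^ (T.card - 1) * (a / 2 * B ^ (2 - n * ε)) := by
          gcongr
          linarith
      _ ≤ (smoothBetween T Y P).card * (a / 2 * B ^ (2 - n * ε)) :=
          mul_le_mul_of_nonneg_right (hsmooth Y hY1) (by positivity)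
      _ ≤ ∑ M ∈ smoothBetween T Y P, ((A b M).card : ℝ) := by
          rw [← nsmul_eq_mul, ← Finset.sum_const]
          exact Finset.sum_le_sum hA
      _ ≤ _ := hUE'
  have hzero : (2 * n : ℝ) ≤ W / 2 * (B ^ (2 - n * ε) * Real.log B ^ (T.card - 1)) := by
    rw [div_le_iff₀ hW0] at hBW
    have h1 : B ^ (2 - n * ε) * 1 ≤ B ^ (2 - n * ε) * Real.log B ^ (T.card - 1) := by
      gcongr
      exact one_le_pow₀ hlogB
    nlinarith
  rw [div_mul_eq_mul_div, le_div_iff₀ hW0]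
  linarith

theorem theorem1p6 (n : ℕ) (hn : 3 ≤ n) (F : MvPolynomial (Fin 2) ℤ) (hF : F.IsHomogeneous n)
    (hD : formDiscr n F ≠ 0) (ε : ℝ) (hε0 : 0 < ε) (hε1 : ε < 1 / (n : ℝ))
    (S : Finset ℕ) (hS : ∀ p ∈ S, p.Prime) (hs : 0 < numSolvablePrimes n F S) :
    (fun B : ℝ => (countLargeSPart F S ε B : ℝ)) =Θ[atTop]
      (fun B : ℝ => B ^ (2 - (n : ℝ) * ε) * Real.log B ^ (numSolvablePrimes n F S - 1)) :=
  ⟨countLargeSPart_isBigO n hn F hF hD ε hε0 hε1 S hS hs,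
    isBigO_countLargeSPart n hn F hF hD ε hε0 hε1 S hS hs⟩
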